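/- Let $Spin(7)$ act on $\mathbb{R}^8$ by the spin representation and hence transitively on the unit sphere $S^7=Spin(7)/G_2$. A 3-form $\varphi$ on a 7-dimensional vector space is called positive if there are an inner product $g_\varphi$ and one of its two volume forms $\operatorname{dvol}_\varphi$ with $\frac16\,\iota_X\varphi\wedge\iota_Y\varphi\wedge\varphi=g_\varphi(X,Y)\operatorname{dvol}_\varphi$ for all $X,Y$; these are then unique, and $*_\varphi$ denotes their Hodge star. A 3-form on $S^7$ is positive if it is smooth and positive at every point. Let $\mathcal P$ be the set of positive $Spin(7)$-invariant 3-forms on $S^7$, and for $\varphi\in\mathcal P$ let $\Delta_\varphi\varphi=*_\varphi d*_\varphi d\varphi-d*_\varphi d*_\varphi\varphi$ be the $G_2$-Laplacian (the Hodge Laplacian of the metric $g_\varphi$ applied to $\varphi$). Then $\mathcal P\neq\emptyset$, and the $G_2$-Laplacian $\varphi\mapsto\Delta_\varphi\varphi$ is a bijection $\mathcal P\to\mathcal P$ which is orientation-preserving: $\varphi$ and $\Delta_\varphi\varphi$ induce the same orientation of $S^7$. Moreover, for every $\varphi_0\in\mathcal P$ the map $A\mapsto A^3\varphi_0$ is a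 bijection from $\mathbb{R}\setminus\{0\}$ onto $\mathcal P$, and there is a real constant $K\neq0$ such that $d\varphi_0=K*_{\varphi_0}\varphi_0$, such that $$\Delta_{A^3\varphi_0}(A^3\varphi_0)=AK^2\varphi_0\qquad\text{for all }A\in\mathbb{R}\setminus\{0\},$$ and such that the $G_2$-Laplacian has exactly two fixed points in $\mathcal P$, namely $K^3\varphi_0$ and $-K^3\varphi_0$. -/

import Mathlib

open scoped Manifold ContDiff

noncomputable section

namespace G2Laplacian

/-! ## Exterior algebra on a real vector space -/

section Pointwise

theorem append_update_right {k m : ℕ} {V : Type*} (w : Fin k → V) (v : Fin m → V) (i : Fin m)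
    (z : V) : Fin.append w (Function.update v i z) =
      Function.update (Fin.append w v) (Fin.natAdd k i) z := by
  funext j
  refine Fin.addCases (fun l => ?_) (fun l => ?_) j
  · rw [Function.update_of_ne (by simp [Fin.ext_iff]; omega)]
    simp
  · by_cases hl : l = i
    · subst hl; simp
    · rw [Function.update_of_ne (by simpa [Fin.ext_iff] using hl)]
      simp [hl]

variable {V : Type*} [AddCommGroup V] [Module ℝ V] [TopologicalSpace V]

/-- The wedge product of alternating forms (sum over shuffles, so that
`(e¹ ∧ e²) (e₁, e₂) = 1`). -/
def wedge {p q : ℕ} (a : V [⋀^Fin p]→ₗ[ℝ] ℝ) (b : V [⋀^Fin q]→ₗ[ℝ] ℝ) :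
    V [⋀^Fin (p + q)]→ₗ[ℝ] ℝ :=
  ((LinearMap.mul' ℝ ℝ).compAlternatingMap (a.domCoprod b)).domDomCongr finSumFinEquiv

/-- The interior product `ι_X φ = φ (X, ⬝, ⬝)` of a 3-form. -/
def interior (X : V) (φ : V [⋀^Fin 3]→L[ℝ] ℝ) : V [⋀^Fin 2]→ₗ[ℝ] ℝ :=
  φ.toAlternatingMap.curryLeft X

/-- The 3-form `φ` induces the inner product `g` and the volume form `vol`: `g` is symmetric and
positive definite, `vol = ± √(det g)`, that is, `vol` is one of the two volume forms of `g`,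
and `(1/6) ι_X φ ∧ ι_Y φ ∧ φ = g(X, Y) vol` for all `X`, `Y`. -/
structure Induces (φ : V [⋀^Fin 3]→L[ℝ] ℝ) (g : LinearMap.BilinForm ℝ V)
    (vol : V [⋀^Fin 7]→L[ℝ] ℝ) : Prop where
  symm : ∀ X Y, g X Y = g Y X
  pos : ∀ X, X ≠ 0 → 0 < g X X
  vol_sq : ∀ v : Fin 7 → V, vol v ^ 2 = (Matrix.of fun i j => g (v i) (v j)).det
  eqn : ∀ X Y, (1 / 6 : ℝ) • wedge (wedge (interior X φ) (interior Y φ)) φ.toAlternatingMap =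
    g X Y • vol.toAlternatingMap

/-- A 3-form (on a 7-dimensional space) is positive if it induces an inner product. -/
def IsPositive (φ : V [⋀^Fin 3]→L[ℝ] ℝ) : Prop :=
  ∃ p : LinearMap.BilinForm ℝ V × (V [⋀^Fin 7]→L[ℝ] ℝ), Induces φ p.1 p.2

open Classical in
/-- The inner product `g_φ` and the volume form `dvol_φ` induced by a positive 3-form `φ` on a
7-dimensional space (the pair is unique); the value is `0` if `φ` is not positive. -/
def induced (φ : V [⋀^Fin 3]→L[ℝ] ℝ) : LinearMap.BilinForm ℝ V × (V [⋀^Fin 7]→L[ℝ] ℝ) :=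
  if h : IsPositive φ then h.choose else 0

/-- The inner product `g_φ` induced by `φ`. -/
def inducedMetric (φ : V [⋀^Fin 3]→L[ℝ] ℝ) : LinearMap.BilinForm ℝ V := (induced φ).1

/-- The volume form `dvol_φ` induced by `φ`. -/
def inducedVol (φ : V [⋀^Fin 3]→L[ℝ] ℝ) : V [⋀^Fin 7]→L[ℝ] ℝ := (induced φ).2

/-- Insert `w` into the first `k` slots of a `(k + m)`-form: `c (w₁, …, w_k, ⬝, …, ⬝)`. -/
def insertFirst {k m : ℕ} (c : V [⋀^Fin (k + m)]→L[ℝ] ℝ) (w : Fin k → V) :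
    V [⋀^Fin m]→L[ℝ] ℝ where
  toFun v := c (Fin.append w v)
  map_update_add' v i x y := by
    classical
    convert c.map_update_add (Fin.append w v) (Fin.natAdd k i) x y using 3
    all_goals convert! append_update_right w v i _
  map_update_smul' v i r x := by
    classical
    convert c.map_update_smul (Fin.append w v) (Fin.natAdd k i) r x using 3
    all_goals convert! append_update_right w v i _
  map_eq_zero_of_eq' v i j hv hij := by
    refine c.map_eq_zero_of_eq (Fin.append w v) (i := Fin.natAdd k i) (j := Fin.natAdd k j) ?_ ?_
    · simpa using hv
    · simpa [Fin.ext_iff] using hij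
  cont := by
    refine c.cont.comp (continuous_pi fun j => ?_)
    refine Fin.addCases (fun l => ?_) (fun l => ?_) j
    · simpa using continuous_const
    · simpa using continuous_apply l

/-- A form of degree `n`, regarded as a form of degree `n' = n`. -/
def castDegree {n n' : ℕ} (h : n = n') (c : V [⋀^Fin n]→L[ℝ] ℝ) : V [⋀^Fin n']→L[ℝ] ℝ :=
  h ▸ c

open Classical in
/-- The Hodge star of a `k`-form `a` on a space of dimension `k + m` with inner product `g` and
volume form `vol`, in terms of a `g`-orthonormal basis `e` (the result does not depend on `e`):
`*a = (1/k!) ∑_{i₁, …, i_k} a(e_{i₁}, …, e_{i_k}) vol(e_{i₁}, …, e_{i_k}, ⬝, …, ⬝)`. -/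
def hodgeStar {k m : ℕ} (g : LinearMap.BilinForm ℝ V) (vol : V [⋀^Fin (k + m)]→L[ℝ] ℝ)
    (a : V [⋀^Fin k]→L[ℝ] ℝ) : V [⋀^Fin m]→L[ℝ] ℝ :=
  if h : ∃ e : Module.Basis (Fin (k + m)) ℝ V, ∀ i j, g (e i) (e j) = if i = j then 1 else 0 then
    (1 / (k.factorial : ℝ)) • ∑ I : Fin k → Fin (k + m),
      a (fun l => h.choose (I l)) • insertFirst vol (fun l => h.choose (I l))
  else 0

end Pointwise

/-! ## Differential forms on a 7-manifold -/

/-- The model space of 7-manifolds. -/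
abbrev E7 : Type := EuclideanSpace ℝ (Fin 7)

section Forms

variable (M : Type*) [TopologicalSpace M] [ChartedSpace E7 M]

/-- (Not necessarily continuous) differential `k`-forms on a 7-manifold `M`. -/
abbrev DiffForm (k : ℕ) : Type _ := (x : M) → TangentSpace (𝓡 7) x [⋀^Fin k]→L[ℝ] ℝ

end Forms

section Operators

variable {M : Type*} [TopologicalSpace M] [ChartedSpace E7 M]

/-- The pullback `f^* α` of a differential form. -/
def pullback {k : ℕ} (f : M → M) (α : DiffForm M k) : DiffForm M k := fun x =>
  (α (f x)).compContinuousLinearMap (mfderiv (𝓡 7) (𝓡 7) f x)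

/-- The expression of `α` in the preferred chart at `x`, i.e. the pullback of `α` by the inverse of
the chart. -/
def chartForm {k : ℕ} (α : DiffForm M k) (x : M) : E7 → E7 [⋀^Fin k]→L[ℝ] ℝ := fun y =>
  (α ((extChartAt (𝓡 7) x).symm y)).compContinuousLinearMap
    (mfderiv 𝓘(ℝ, E7) (𝓡 7) (extChartAt (𝓡 7) x).symm y)

/-- A differential form is smooth if it is smooth in charts. -/
def IsSmooth {k : ℕ} (α : DiffForm M k) : Prop :=
  ∀ x : M, ContDiffOn ℝ ∞ (chartForm α x) (extChartAt (𝓡 7) x).target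

/-- The exterior derivative, computed at `x` in the preferred chart at `x`. -/
def extd {k : ℕ} (α : DiffForm M k) : DiffForm M (k + 1) := fun x =>
  (extDeriv (chartForm α x) (extChartAt (𝓡 7) x x)).compContinuousLinearMap
    (mfderiv (𝓡 7) 𝓘(ℝ, E7) (extChartAt (𝓡 7) x) x)

/-- A `G₂`-structure: a smooth everywhere positive 3-form. -/
def IsG2Structure (φ : DiffForm M 3) : Prop :=
  IsSmooth φ ∧ ∀ x, IsPositive (φ x)

/-- The Hodge star `*_φ` from `k`-forms to `m`-forms, `k + m = 7`, of the metric and the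
orientation induced by `φ`. -/
def starOf (φ : DiffForm M 3) (k m : ℕ) (h : k + m = 7) (α : DiffForm M k) : DiffForm M m :=
  fun x => hodgeStar (inducedMetric (φ x))
    (castDegree h.symm (inducedVol (φ x))) (α x)

/-- The codifferential `δ_φ = (-1)^k *_φ d *_φ` on `k`-forms, here with `k = j + 1` and
`j + 1 + m = 7`. -/
def codiff (φ : DiffForm M 3) (j m : ℕ) (h : j + 1 + m = 7) (α : DiffForm M (j + 1)) :
    DiffForm M j :=
  ((-1 : ℝ) ^ (j + 1)) • starOf φ (m + 1) j (by omega) (extd (starOf φ (j + 1) m h α))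

/-- The Hodge Laplacian `Δ_φ = (d + δ_φ)² = δ_φ d + d δ_φ` on 3-forms. -/
def hodgeLaplacian (φ α : DiffForm M 3) : DiffForm M 3 :=
  codiff φ 3 3 rfl (extd α) + extd (codiff φ 2 4 rfl α)

/-- The `G₂`-Laplacian `φ ↦ Δ_φ φ`. -/
def g2Laplacian (φ : DiffForm M 3) : DiffForm M 3 := hodgeLaplacian φ φ

/-- The 3-forms `φ` and `ψ` induce the same orientation of `M`. -/
def SameOrientation (φ ψ : DiffForm M 3) : Prop :=
  ∀ x, ∃ c : ℝ, 0 < c ∧ inducedVol (ψ x) = c • inducedVol (φ x)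

end Operators

/-! ## The group `Spin(7)` and its action on the 7-sphere -/

/-- The quadratic form `-|v|²` on `ℝ⁷`. -/
def Q7 : QuadraticForm ℝ (Fin 7 → ℝ) := QuadraticMap.weightedSumSquares ℝ (fun _ => (-1 : ℝ))

/-- Clifford multiplication of `ℝ⁷` on the spinor space `ℝ⁸`: identifying `ℝ⁸` with the octonions
and `ℝ⁷` with the imaginary octonions, this is left multiplication by `v`; the multiplication
of imaginary units is the one given by the 3-form
`e¹²³ + e¹⁴⁵ + e¹⁶⁷ + e²⁴⁶ - e²⁵⁷ - e³⁴⁷ - e³⁵⁶`. -/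
def cliffordMul : (Fin 7 → ℝ) →ₗ[ℝ] Matrix (Fin 8) (Fin 8) ℝ where
  toFun v :=
    !![0, -v 0, -v 1, -v 2, -v 3, -v 4, -v 5, -v 6;
       v 0, 0, -v 2, v 1, -v 4, v 3, -v 6, v 5;
       v 1, v 2, 0, -v 0, -v 5, v 6, v 3, -v 4;
       v 2, -v 1, v 0, 0, v 6, v 5, -v 4, -v 3;
       v 3, v 4, v 5, -v 6, 0, -v 0, -v 1, v 2;
       v 4, -v 3, -v 6, -v 5, v 0, 0, v 2, v 1;
       v 5, v 6, -v 3, v 4, v 1, -v 2, 0, -v 0;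
       v 6, -v 5, v 4, v 3, -v 2, -v 1, v 0, 0]
  map_add' v w := by
    ext i j
    revert i j
    simp [Fin.forall_fin_succ, neg_add, -neg_add_rev]
  map_smul' c v := by
    ext i j
    revert i j
    simp [Fin.forall_fin_succ]

theorem cliffordMul_mul_self (v : Fin 7 → ℝ) :
    cliffordMul v * cliffordMul v = algebraMap ℝ (Matrix (Fin 8) (Fin 8) ℝ) (Q7 v) := by
  have hQ : Q7 v = -(v 0 * v 0 + v 1 * v 1 + v 2 * v 2 + v 3 * v 3 + v 4 * v 4 + v 5 * v 5 +
      v 6 * v 6) := by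
    simp [Q7, QuadraticMap.weightedSumSquares_apply, Fin.sum_univ_seven]
  rw [hQ, Matrix.algebraMap_eq_diagonal]
  ext i j
  simp only [Matrix.mul_apply, Fin.sum_univ_eight, Matrix.diagonal_apply]
  revert i j
  simp [cliffordMul, Fin.forall_fin_succ]
  ring_nf
  simp

theorem cliffordMul_transpose (v : Fin 7 → ℝ) :
    (cliffordMul v).transpose = -cliffordMul v := by
  ext i j
  revert i j
  simp [cliffordMul, Fin.forall_fin_succ]

/-- The spinor representation of the Clifford algebra of `ℝ⁷` on `ℝ⁸`. -/
def spinorRep : CliffordAlgebra Q7 →ₐ[ℝ] Matrix (Fin 8) (Fin 8) ℝ :=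
  CliffordAlgebra.lift Q7 ⟨cliffordMul, cliffordMul_mul_self⟩

theorem spinorRep_star (x : CliffordAlgebra Q7) : spinorRep (star x) = star (spinorRep x) := by
  induction x using CliffordAlgebra.induction with
  | algebraMap r =>
    rw [CliffordAlgebra.star_algebraMap, AlgHom.commutes, ← algebraMap_star_comm, star_trivial]
  | ι v =>
    rw [CliffordAlgebra.star_ι, map_neg, spinorRep, CliffordAlgebra.lift_ι_apply,
      Matrix.star_eq_conjTranspose, Matrix.conjTranspose_eq_transpose_of_trivial]
    exact (cliffordMul_transpose v).symm
  | mul a b ha hb => rw [star_mul, map_mul, map_mul, star_mul, ha, hb]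
  | add a b ha hb => rw [star_add, map_add, map_add, star_add, ha, hb]

/-- The 7-sphere, the unit sphere of `ℝ⁸`. -/
abbrev S7 : Type := Metric.sphere (0 : EuclideanSpace ℝ (Fin 8)) 1

theorem norm_spinorRep (s : spinGroup Q7) (x : EuclideanSpace ℝ (Fin 8)) :
    ‖Matrix.toEuclideanCLM (𝕜 := ℝ) (spinorRep (s : CliffordAlgebra Q7)) x‖ = ‖x‖ := by
  have h1 : star (s : CliffordAlgebra Q7) * (s : CliffordAlgebra Q7) = 1 :=
    spinGroup.star_mul_self_of_mem s.2
  set T := Matrix.toEuclideanCLM (𝕜 := ℝ) (spinorRep (s : CliffordAlgebra Q7)) with hT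
  have h2 : star T * T = 1 := by
    rw [hT, ← map_star, ← spinorRep_star, ← map_mul, ← map_mul, h1, map_one, map_one]
  have h3 : inner ℝ (T x) (T x) = inner ℝ x x := by
    rw [← ContinuousLinearMap.adjoint_inner_right]
    have := congrArg (fun A : EuclideanSpace ℝ (Fin 8) →L[ℝ] EuclideanSpace ℝ (Fin 8) => A x) h2
    simpa [ContinuousLinearMap.star_eq_adjoint] using congrArg (inner ℝ x) this
  rw [real_inner_self_eq_norm_sq, real_inner_self_eq_norm_sq] at h3
  exact (sq_eq_sq₀ (norm_nonneg _) (norm_nonneg _)).1 h3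

/-- The action of `s ∈ Spin(7)` on the 7-sphere through the spinor representation. -/
def spinAct (s : spinGroup Q7) (x : S7) : S7 :=
  ⟨Matrix.toEuclideanCLM (𝕜 := ℝ) (spinorRep (s : CliffordAlgebra Q7)) x, by
    rw [mem_sphere_zero_iff_norm, norm_spinorRep]
    exact mem_sphere_zero_iff_norm.1 x.2⟩

/-- A differential form on the 7-sphere is `Spin(7)`-invariant. -/
def IsSpin7Invariant {k : ℕ} (α : DiffForm S7 k) : Prop :=
  ∀ s : spinGroup Q7, pullback (spinAct s) α = α

/-- The space of (smooth) positive `Spin(7)`-invariant 3-forms on the 7-sphere. -/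
def posSpin7Forms : Set (DiffForm S7 3) :=
  {φ | IsG2Structure φ ∧ IsSpin7Invariant φ}

end G2Laplacian

end

/-!
The positive `Spin(7)`-invariant 3-forms on `S⁷` are the nonzero multiples of one form, and the
`G₂`-Laplacian of such a multiple is computed from its behaviour under scaling.

*The standard form.* Clifford multiplication by the seven imaginary units gives 2-forms `ωᵢ` on
`ℝ⁸`. Conjugation by an element of `Spin(7)` acts on the imaginary octonions, orthogonally, so the
Cayley form `Φ = (1/6) ∑ᵢ ωᵢ ∧ ωᵢ` is invariant (`cayleyForm_spinorOp`). The restriction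
`φ` of `ι_x Φ` to the sphere is then an invariant 3-form. Since `x ↦ ι_x Φ` is linear, its exterior
derivative is `4 Φ`, and `d φ = 4 ψ`, `d ψ = 0` for the restriction `ψ` of `Φ`
(`extd_smul_stdForm`, `extd_smul_stdFourForm`).

*The pointwise algebra.* At the pole, in the basis of imaginary units, `φ` and `ψ` have the
coefficients of the associative and the coassociative form; by invariance each tangent space has
such a basis (`exists_frame`, `isG2Frame_stdForm`). In such a basis one computes that `φ` is
positive, that the basis is orthonormal for the induced metric (`IsG2Frame.induces`), and that the
Hodge star exchanges `φ` and `ψ` (`IsG2Frame.hodgeStar_assoc`, `IsG2Frame.hodgeStar_coassoc`). The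
pair of a metric and a volume form induced by a 3-form is unique (`Induces.unique`), and `A³ φ`
induces `A² g` and `A⁷ vol` (`Induces.smul`). Consequently the star of `A³ φ` maps `φ` to `A ψ` and
`ψ` to `A⁻¹ φ`, whence `Δ (A³ φ) = 16 A φ` (`g2Laplacian_smul_stdForm`).

*Classification.* `Spin(7)` is transitive on the sphere, so an invariant form is determined by its
value at the pole. There, four elements of the stabiliser, which permute the imaginary units up to
sign, suffice to reduce an invariant 3-form to its coefficient at `(e₁, e₂, e₃)`
(`IsSpin7Invariant.eq_zero_of_apply`). Hence every invariant 3-form is a multiple of `φ`, the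
positive ones being the nonzero multiples, and each of these is `A³ φ` for a unique `A ≠ 0`
(`mem_posSpin7Forms_iff`). The Laplacian thus acts on the cubes `A³` by `A³ ↦ 16 A`, which is a
bijection of `ℝ ∖ {0}` preserving signs, with fixed points `±64`.
-/

noncomputable section

namespace G2Laplacian

/-! ### Restricting ambient forms to the sphere -/

/-- The ambient space of the 7-sphere. -/
abbrev E8 : Type := EuclideanSpace ℝ (Fin 8)

/-- The differential of the inclusion `S⁷ ⊆ ℝ⁸`. -/
def inclDeriv (x : S7) : TangentSpace (𝓡 7) x →L[ℝ] E8 :=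
  mvfderiv (𝓡 7) (Subtype.val : S7 → E8) x

/-- The restriction (pullback by the inclusion) of a differential form on `ℝ⁸` to `S⁷`. -/
def restrict {k : ℕ} (β : E8 → E8 [⋀^Fin k]→L[ℝ] ℝ) : DiffForm S7 k := fun x =>
  (β x).compContinuousLinearMap (inclDeriv x)

theorem finrank_E8 : Fact (Module.finrank ℝ E8 = 7 + 1) := ⟨by simp⟩

section

attribute [local instance] finrank_E8

theorem inclDeriv_injective (x : S7) : Function.Injective (inclDeriv x) :=
  injective_mvfderiv_subtypeVal_sphere x

theorem range_inclDeriv (x : S7) :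
    (inclDeriv x).range = (Submodule.span ℝ {(x : E8)})ᗮ :=
  range_mvfderiv_subtypeVal x

theorem mdifferentiable_val :
    MDifferentiable (𝓡 7) 𝓘(ℝ, E8) (Subtype.val : S7 → E8) :=
  (contMDiff_coe_sphere (m := 1)).mdifferentiable one_ne_zero

theorem contMDiff_val : ContMDiff (𝓡 7) 𝓘(ℝ, E8) ω (Subtype.val : S7 → E8) :=
  contMDiff_coe_sphere

end

/-- The parametrisation of `S⁷` by the inverse of the preferred chart at `x`, as a map to `ℝ⁸`. -/
def chartInv (x : S7) (y : E7) : E8 := ((extChartAt (𝓡 7) x).symm y : S7)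

theorem extChartAt_target (x : S7) : (extChartAt (𝓡 7) x).target = Set.univ := by
  simp [extChartAt, chartAt, ChartedSpace.chartAt]

theorem contMDiff_extChartAt_symm_sphere (x : S7) :
    ContMDiff 𝓘(ℝ, E7) (𝓡 7) ω ((extChartAt (𝓡 7) x).symm) := by
  have := contMDiffOn_extChartAt_symm (I := 𝓡 7) (n := ω) x
  rwa [extChartAt_target, contMDiffOn_univ] at this

theorem contDiff_chartInv (x : S7) : ContDiff ℝ ω (chartInv x) := by
  rw [← contMDiff_iff_contDiff]
  exact contMDiff_val.comp (contMDiff_extChartAt_symm_sphere x)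

theorem fderiv_chartInv (x : S7) (y : E7) :
    fderiv ℝ (chartInv x) y = (inclDeriv ((extChartAt (𝓡 7) x).symm y)).comp
      (mfderiv 𝓘(ℝ, E7) (𝓡 7) (extChartAt (𝓡 7) x).symm y) := by
  rw [← mfderiv_eq_fderiv]
  exact mfderiv_comp y (mdifferentiable_val _)
    ((contMDiff_extChartAt_symm_sphere x).mdifferentiable (by simp) y)

theorem chartForm_restrict {k : ℕ} (β : E8 → E8 [⋀^Fin k]→L[ℝ] ℝ) (x : S7) :
    chartForm (restrict β) x =
      fun y => (β (chartInv x y)).compContinuousLinearMap (fderiv ℝ (chartInv x) y) := by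
  funext y
  rw [fderiv_chartInv]
  rfl

theorem chartInv_self (x : S7) : chartInv x (extChartAt (𝓡 7) x x) = x := by
  simp [chartInv]

theorem fderiv_chartInv_comp (x : S7) :
    (fderiv ℝ (chartInv x) (extChartAt (𝓡 7) x x)).comp
      (mfderiv (𝓡 7) 𝓘(ℝ, E7) (extChartAt (𝓡 7) x) x) = inclDeriv x := by
  have h1 : MDifferentiableAt (𝓡 7) 𝓘(ℝ, E7) (extChartAt (𝓡 7) x) x :=
    mdifferentiableAt_extChartAt (mem_chart_source E7 x)
  have h2 : MDifferentiableAt 𝓘(ℝ, E7) 𝓘(ℝ, E8) (chartInv x) (extChartAt (𝓡 7) x x) :=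
    ((contDiff_chartInv x).differentiable (by simp) _).mdifferentiableAt
  have h3 : chartInv x ∘ extChartAt (𝓡 7) x =ᶠ[nhds x] Subtype.val := by
    filter_upwards [extChartAt_source_mem_nhds (I := 𝓡 7) x] with y hy
    simp only [chartInv, Function.comp_apply, (extChartAt (𝓡 7) x).left_inv hy]
  have h4 := mfderiv_comp x h2 h1
  rw [h3.mfderiv_eq, mfderiv_eq_fderiv] at h4
  exact h4.symm

/-- The exterior derivative commutes with restriction to the sphere. -/
theorem extd_restrict {k : ℕ} {β : E8 → E8 [⋀^Fin k]→L[ℝ] ℝ} (hβ : Differentiable ℝ β) :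
    extd (restrict β) = restrict (extDeriv β) := by
  funext x
  rw [extd, chartForm_restrict,
    extDeriv_pullback (r := ω) (hβ _) (contDiff_chartInv x).contDiffAt (by simp), chartInv_self,
    restrict, ← fderiv_chartInv_comp]
  rfl

theorem continuousAlternating_ext_basis {k : ℕ} {ι E : Type*} [NormedAddCommGroup E]
    [NormedSpace ℝ E] (b : Module.Basis ι ℝ E) (f g : E [⋀^Fin k]→L[ℝ] ℝ)
    (h : ∀ J : Fin k → ι, f (b ∘ J) = g (b ∘ J)) : f = g := by
  apply ContinuousAlternatingMap.toAlternatingMap_injective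
  exact Module.Basis.ext_alternating b fun J _ => h J

/-- A family of alternating forms on a finite-dimensional space is smooth if all its values are. -/
theorem contDiff_alternating_of_apply {k : ℕ} {E F : Type*} [NormedAddCommGroup E]
    [NormedSpace ℝ E] [FiniteDimensional ℝ E] [NormedAddCommGroup F] [NormedSpace ℝ F]
    {n : ℕ∞ω} {f : F → E [⋀^Fin k]→L[ℝ] ℝ} (h : ∀ v, ContDiff ℝ n fun y => f y v) :
    ContDiff ℝ n f := by
  let b := Module.finBasis ℝ E
  let ev : (E [⋀^Fin k]→L[ℝ] ℝ) →ₗ[ℝ] ((Fin k → Fin (Module.finrank ℝ E)) → ℝ) :=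
    { toFun := fun a J => a (b ∘ J)
      map_add' := fun _ _ => rfl
      map_smul' := fun _ _ => rfl }
  have hev : Function.Injective ev := fun a c hac =>
    continuousAlternating_ext_basis b a c fun J => congrFun hac J
  obtain ⟨g, hg⟩ := ev.exists_leftInverse_of_injective (LinearMap.ker_eq_bot.2 hev)
  have hf : f = fun y => g.toContinuousLinearMap (ev (f y)) :=
    funext fun y => (LinearMap.congr_fun hg (f y)).symm
  rw [hf]
  exact g.toContinuousLinearMap.contDiff.comp (contDiff_pi.2 fun J => h _)

theorem isSmooth_restrict {k : ℕ} {β : E8 → E8 [⋀^Fin k]→L[ℝ] ℝ} (hβ : ContDiff ℝ ∞ β) :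
    IsSmooth (restrict β) := by
  intro x
  rw [chartForm_restrict]
  refine (contDiff_alternating_of_apply fun v => ?_).contDiffOn
  have h1 : ContDiff ℝ ∞ (chartInv x) := (contDiff_chartInv x).of_le le_top
  have h2 : ContDiff ℝ ∞ (fderiv ℝ (chartInv x)) :=
    (contDiff_chartInv x).fderiv_right (m := ∞) (by exact le_top)
  have h3 : ContDiff ℝ ∞ fun y =>
      ContinuousMultilinearMap.compContinuousLinearMapContinuousMultilinear ℝ
        (fun _ : Fin k => E7) (fun _ : Fin k => E8) ℝ (fun _ => fderiv ℝ (chartInv x) y) :=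
    (ContinuousMultilinearMap.contDiff _).comp (contDiff_pi.2 fun _ => h2)
  have h4 : ContDiff ℝ ∞ fun y =>
      ContinuousAlternatingMap.toContinuousMultilinearMapCLM ℝ (β (chartInv x y)) :=
    (ContinuousLinearMap.contDiff _).comp (hβ.comp h1)
  exact (ContinuousMultilinearMap.apply ℝ (fun _ : Fin k => E7) ℝ v).contDiff.comp
    (h3.clm_apply h4)

theorem restrict_smul {k : ℕ} (c : ℝ) (β : E8 → E8 [⋀^Fin k]→L[ℝ] ℝ) :
    restrict (c • β) = c • restrict β := rfl

theorem restrict_zero {k : ℕ} : restrict (0 : E8 → E8 [⋀^Fin k]→L[ℝ] ℝ) = 0 := rfl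

/-! ### Multilinear algebra in a basis -/

section Algebra

variable {V : Type*} [AddCommGroup V] [Module ℝ V]

/-- Two alternating forms agree if they agree on increasing tuples of basis vectors. -/
theorem alternating_ext_strictMono {k N : ℕ} (e : Module.Basis (Fin N) ℝ V)
    {a b : V [⋀^Fin k]→ₗ[ℝ] ℝ}
    (h : ∀ J : Fin k → Fin N, StrictMono J → a (e ∘ J) = b (e ∘ J)) : a = b := by
  refine Module.Basis.ext_alternating e fun J hJ => ?_
  have h1 : StrictMono (J ∘ Tuple.sort J) :=
    (Tuple.monotone_sort J).strictMono_of_injective (hJ.comp (Tuple.sort J).injective)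
  have h2 := h _ h1
  rw [← Function.comp_assoc, a.map_perm, b.map_perm] at h2
  exact smul_left_cancel _ h2

/-- The Levi-Civita symbol of a tuple, as a product of signs of differences. -/
def leviCivita {n N : ℕ} (I : Fin n → Fin N) : ℤ :=
  ∏ j, ∏ i ∈ Finset.Iio j, if I i < I j then 1 else if I j < I i then -1 else 0

theorem injective_of_leviCivita_ne_zero {n N : ℕ} {I : Fin n → Fin N} (h : leviCivita I ≠ 0) :
    Function.Injective I := by
  have key : ∀ i j, i < j → I i ≠ I j := by
    intro i j hij he
    apply h
    refine Finset.prod_eq_zero (Finset.mem_univ j) ?_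
    refine Finset.prod_eq_zero (Finset.mem_Iio.2 hij) ?_
    simp [he]
  intro i j he
  rcases lt_trichotomy i j with hij | hij | hij
  · exact absurd he (key _ _ hij)
  · exact hij
  · exact absurd he.symm (key _ _ hij)

theorem leviCivita_perm {n : ℕ} (σ : Equiv.Perm (Fin n)) :
    leviCivita σ = (Equiv.Perm.sign σ : ℤ) := by
  rw [Equiv.Perm.sign_eq_prod_prod_Iio, leviCivita]
  push_cast
  refine Finset.prod_congr rfl fun j _ => Finset.prod_congr rfl fun i hi => ?_
  have hij : σ i ≠ σ j := fun h => (Finset.mem_Iio.1 hi).ne (σ.injective h)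
  rcases lt_or_gt_of_ne hij with h | h
  · simp [h]
  · simp [h, h.not_gt]

theorem alternating_apply_leviCivita {n : ℕ} (e : Module.Basis (Fin n) ℝ V)
    (vol : V [⋀^Fin n]→ₗ[ℝ] ℝ) {I : Fin n → Fin n} (hI : Function.Injective I) :
    vol (e ∘ I) = leviCivita I * vol e := by
  obtain ⟨σ, rfl⟩ : ∃ σ : Equiv.Perm (Fin n), I = σ :=
    ⟨Equiv.ofBijective I (Finite.injective_iff_bijective.1 hI), rfl⟩
  rw [vol.map_perm, leviCivita_perm, Units.smul_def]
  simp

/-- The sum `∑_I F(e_I) G(e_I)` over tuples of vectors of a `g`-orthonormal basis `e` does not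
depend on `e`. -/
theorem sum_mul_eq_of_orthonormal {k N : ℕ} (F G : MultilinearMap ℝ (fun _ : Fin k => V) ℝ)
    (g : LinearMap.BilinForm ℝ V) (e f : Module.Basis (Fin N) ℝ V)
    (he : ∀ i j, g (e i) (e j) = if i = j then 1 else 0)
    (hf : ∀ i j, g (f i) (f j) = if i = j then 1 else 0) :
    ∑ I : Fin k → Fin N, F (f ∘ I) * G (f ∘ I) = ∑ I : Fin k → Fin N, F (e ∘ I) * G (e ∘ I) := by
  classical
  set O : Matrix (Fin N) (Fin N) ℝ := Matrix.of fun i j => e.repr (f i) j with hO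
  have hfe : ∀ i, f i = ∑ j, O i j • e j := fun i => (e.sum_repr (f i)).symm
  have hOO : O * O.transpose = 1 := by
    ext i j
    have := hf i j
    rw [hfe i, hfe j] at this
    simp only [map_sum, map_smul, LinearMap.sum_apply, LinearMap.smul_apply, he, smul_eq_mul,
      mul_ite, mul_one, mul_zero, Finset.sum_ite_eq', Finset.mem_univ,
      if_true] at this
    simp only [Matrix.mul_apply, Matrix.transpose_apply, Matrix.one_apply, ← this]
    exact Finset.sum_congr rfl fun _ _ => by ring
  have hOO' : ∀ i j, ∑ l, O l i * O l j = if i = j then 1 else 0 := by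
    intro i j
    have h1 : O.transpose * O = 1 := mul_eq_one_comm.1 hOO
    have := congrFun (congrFun h1 i) j
    simpa [Matrix.mul_apply, Matrix.one_apply] using this
  have hexp : ∀ (H : MultilinearMap ℝ (fun _ : Fin k => V) ℝ) (I : Fin k → Fin N),
      H (f ∘ I) = ∑ J : Fin k → Fin N, (∏ l, O (I l) (J l)) * H (e ∘ J) := by
    intro H I
    have : f ∘ I = fun l => ∑ j, O (I l) j • e j := funext fun l => hfe (I l)
    rw [this, MultilinearMap.map_sum]
    refine Finset.sum_congr rfl fun J _ => ?_
    rw [MultilinearMap.map_smul_univ, smul_eq_mul]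
    rfl
  have hprod : ∀ J J' : Fin k → Fin N,
      ∑ I : Fin k → Fin N, (∏ l, O (I l) (J l)) * (∏ l, O (I l) (J' l)) =
        if J = J' then 1 else 0 := by
    intro J J'
    simp_rw [← Finset.prod_mul_distrib]
    rw [← Fintype.prod_sum fun l i => O i (J l) * O i (J' l)]
    simp_rw [hOO']
    by_cases h : J = J'
    · simp [h]
    · obtain ⟨l, hl⟩ := Function.ne_iff.1 h
      rw [if_neg h]
      exact Finset.prod_eq_zero (Finset.mem_univ l) (if_neg hl)
  calc ∑ I : Fin k → Fin N, F (f ∘ I) * G (f ∘ I)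
      = ∑ I : Fin k → Fin N, ∑ J : Fin k → Fin N, ∑ J' : Fin k → Fin N,
          ((∏ l, O (I l) (J l)) * (∏ l, O (I l) (J' l))) * (F (e ∘ J) * G (e ∘ J')) := by
        refine Finset.sum_congr rfl fun I _ => ?_
        rw [hexp F, hexp G, Finset.sum_mul_sum]
        exact Finset.sum_congr rfl fun J _ => Finset.sum_congr rfl fun J' _ => by ring
    _ = ∑ J : Fin k → Fin N, ∑ J' : Fin k → Fin N,
          (∑ I : Fin k → Fin N, (∏ l, O (I l) (J l)) * (∏ l, O (I l) (J' l))) *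
            (F (e ∘ J) * G (e ∘ J')) := by
        rw [Finset.sum_comm]
        refine Finset.sum_congr rfl fun J _ => ?_
        rw [Finset.sum_comm]
        exact Finset.sum_congr rfl fun J' _ => by rw [Finset.sum_mul]
    _ = _ := by simp [hprod]

/-- A sum over all tuples of basis vectors of a product of two top-degree forms. -/
theorem sum_mul_top {n : ℕ} (e : Module.Basis (Fin n) ℝ V) (a b : V [⋀^Fin n]→ₗ[ℝ] ℝ) :
    ∑ I : Fin n → Fin n, a (e ∘ I) * b (e ∘ I) = n.factorial * (a e * b e) := by
  have h : ∑ σ : Equiv.Perm (Fin n), a e * b e =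
      ∑ I : Fin n → Fin n, a (e ∘ I) * b (e ∘ I) := by
    refine Fintype.sum_of_injective (fun σ : Equiv.Perm (Fin n) => (σ : Fin n → Fin n))
      DFunLike.coe_injective _ _ ?_ ?_
    · intro I hI
      have hI' : ¬ Function.Injective I := fun h =>
        hI ⟨Equiv.ofBijective I (Finite.injective_iff_bijective.1 h), rfl⟩
      rw [a.map_eq_zero_of_not_injective _ fun h => hI' (Function.Injective.of_comp h), zero_mul]
    · intro σ
      rw [a.map_perm, b.map_perm, Units.smul_def, Units.smul_def]
      rcases Int.units_eq_one_or (Equiv.Perm.sign σ) with h | h <;> simp [h]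
  rw [← h]
  simp [Fintype.card_perm]

/-- The wedge product as an alternating sum over all permutations. -/
theorem wedge_apply {p q : ℕ} [TopologicalSpace V] (a : V [⋀^Fin p]→ₗ[ℝ] ℝ)
    (b : V [⋀^Fin q]→ₗ[ℝ] ℝ) (v : Fin (p + q) → V) :
    (p.factorial * q.factorial : ℝ) * wedge a b v =
      ∑ σ : Equiv.Perm (Fin (p + q)), ((Equiv.Perm.sign σ : ℤ) : ℝ) *
        (a (v ∘ σ ∘ Fin.castAdd q) * b (v ∘ σ ∘ Fin.natAdd p)) := by
  have h := MultilinearMap.domCoprod_alternization_eq a b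
  have h2 := congrArg (fun f => LinearMap.mul' ℝ ℝ (f (v ∘ finSumFinEquiv))) h
  simp only [AlternatingMap.smul_apply, map_nsmul, Fintype.card_fin,
    MultilinearMap.alternatization_apply, map_sum] at h2
  rw [nsmul_eq_mul] at h2
  push_cast at h2
  refine (h2.symm).trans ?_
  refine Fintype.sum_equiv finSumFinEquiv.permCongr _ _ fun σ => ?_
  rw [Equiv.Perm.sign_permCongr]
  rcases Int.units_eq_one_or (Equiv.Perm.sign σ) with h | h <;> simp [h, Function.comp_def]

/-- Contracting a wedge product with an alternating form. -/
theorem sum_mul_wedge {p q N : ℕ} [TopologicalSpace V] (e : Fin N → V)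
    (c : V [⋀^Fin (p + q)]→ₗ[ℝ] ℝ) (a : V [⋀^Fin p]→ₗ[ℝ] ℝ) (b : V [⋀^Fin q]→ₗ[ℝ] ℝ) :
    (p.factorial * q.factorial : ℝ) * ∑ I : Fin (p + q) → Fin N, c (e ∘ I) * wedge a b (e ∘ I) =
      (p + q).factorial * ∑ I : Fin (p + q) → Fin N, c (e ∘ I) *
        (a (e ∘ I ∘ Fin.castAdd q) * b (e ∘ I ∘ Fin.natAdd p)) := by
  calc (p.factorial * q.factorial : ℝ) *
        ∑ I : Fin (p + q) → Fin N, c (e ∘ I) * wedge a b (e ∘ I)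
      = ∑ I : Fin (p + q) → Fin N, c (e ∘ I) *
          ((p.factorial * q.factorial : ℝ) * wedge a b (e ∘ I)) := by
        rw [Finset.mul_sum]
        exact Finset.sum_congr rfl fun _ _ => by ring
    _ = ∑ σ : Equiv.Perm (Fin (p + q)), ∑ I : Fin (p + q) → Fin N,
          c (e ∘ (I ∘ σ)) * (a (e ∘ (I ∘ σ) ∘ Fin.castAdd q) *
            b (e ∘ (I ∘ σ) ∘ Fin.natAdd p)) := by
        rw [Finset.sum_comm]
        refine Finset.sum_congr rfl fun I _ => ?_
        rw [wedge_apply, Finset.mul_sum]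
        refine Finset.sum_congr rfl fun σ _ => ?_
        rw [← Function.comp_assoc e I σ, c.map_perm, Units.smul_def, zsmul_eq_mul]
        simp only [Function.comp_assoc]
        ring
    _ = ∑ σ : Equiv.Perm (Fin (p + q)), ∑ I : Fin (p + q) → Fin N,
          c (e ∘ I) * (a (e ∘ I ∘ Fin.castAdd q) * b (e ∘ I ∘ Fin.natAdd p)) := by
        refine Finset.sum_congr rfl fun σ _ => ?_
        exact Fintype.sum_equiv (σ.arrowCongr (Equiv.refl _)).symm _ _ fun I => rfl
    _ = _ := by simp [Fintype.card_perm]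

end Algebra

/-! ### The Hodge star in an orthonormal basis -/

theorem append_update_left {k m : ℕ} {V : Type*} (w : Fin k → V) (v : Fin m → V) (i : Fin k)
    (z : V) :
    Fin.append (Function.update w i z) v =
      Function.update (Fin.append w v) (Fin.castAdd m i) z := by
  funext j
  refine Fin.addCases (fun l => ?_) (fun l => ?_) j
  · by_cases hl : l = i
    · subst hl; simp
    · rw [Function.update_of_ne (by simpa [Fin.ext_iff] using hl)]
      simp [hl]
  · rw [Function.update_of_ne (by simp [Fin.ext_iff]; omega)]
    simp

section Hodge

variable {V : Type*} [AddCommGroup V] [Module ℝ V] [TopologicalSpace V]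

/-- The multilinear map `w ↦ c (w, v)` for fixed values `v` of the last slots of a form. -/
def insertLast {k m : ℕ} (c : V [⋀^Fin (k + m)]→L[ℝ] ℝ) (v : Fin m → V) :
    MultilinearMap ℝ (fun _ : Fin k => V) ℝ where
  toFun w := c (Fin.append w v)
  map_update_add' w i x y := by
    classical
    convert c.map_update_add (Fin.append w v) (Fin.castAdd m i) x y using 3
    all_goals convert! append_update_left w v i _
  map_update_smul' w i r x := by
    classical
    convert c.map_update_smul (Fin.append w v) (Fin.castAdd m i) r x using 3
    all_goals convert! append_update_left w v i _

/-- The Hodge star may be computed in any orthonormal basis. -/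
theorem hodgeStar_apply {k m : ℕ} {g : LinearMap.BilinForm ℝ V}
    (vol : V [⋀^Fin (k + m)]→L[ℝ] ℝ) (a : V [⋀^Fin k]→L[ℝ] ℝ)
    {e : Module.Basis (Fin (k + m)) ℝ V} (he : ∀ i j, g (e i) (e j) = if i = j then 1 else 0)
    (v : Fin m → V) :
    hodgeStar g vol a v =
      (1 / (k.factorial : ℝ)) *
        ∑ I : Fin k → Fin (k + m), a (e ∘ I) * vol (Fin.append (e ∘ I) v) := by
  have h : ∃ e : Module.Basis (Fin (k + m)) ℝ V,
      ∀ i j, g (e i) (e j) = if i = j then 1 else 0 := ⟨e, he⟩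
  have hc : ∀ i j, g (h.choose i) (h.choose j) = if i = j then 1 else 0 := by
    intro i j
    convert h.choose_spec i j
  have := sum_mul_eq_of_orthonormal a.toMultilinearMap (insertLast vol v) g e h.choose he hc
  have h2 : hodgeStar g vol a v = (1 / (k.factorial : ℝ)) *
      ∑ I : Fin k → Fin (k + m), a (h.choose ∘ I) * vol (Fin.append (h.choose ∘ I) v) := by
    rw [hodgeStar, dif_pos (by convert h)]
    simp only [ContinuousAlternatingMap.smul_apply, ContinuousAlternatingMap.sum_apply,
      smul_eq_mul]
    rfl
  rw [h2]
  exact congrArg _ this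

/-- The Hodge star of a form on a tuple of basis vectors is given by the complementary tuple. -/
theorem hodgeStar_apply_compl {k m : ℕ} {g : LinearMap.BilinForm ℝ V}
    (vol : V [⋀^Fin (k + m)]→L[ℝ] ℝ) (a : V [⋀^Fin k]→L[ℝ] ℝ)
    {e : Module.Basis (Fin (k + m)) ℝ V} (he : ∀ i j, g (e i) (e j) = if i = j then 1 else 0)
    (K : Fin k → Fin (k + m)) (J : Fin m → Fin (k + m))
    (hKJ : Function.Injective (Fin.append K J)) :
    hodgeStar g vol a (e ∘ J) = a (e ∘ K) * (leviCivita (Fin.append K J) * vol e) := by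
  have happ : ∀ I : Fin k → Fin (k + m), Fin.append (e ∘ I) (e ∘ J) = e ∘ Fin.append I J := by
    intro I
    funext i
    refine Fin.addCases (fun l => ?_) (fun l => ?_) i <;> simp
  have hvol : vol (e ∘ Fin.append K J) = leviCivita (Fin.append K J) * vol e :=
    alternating_apply_leviCivita e vol.toAlternatingMap hKJ
  have hK : Function.Injective K := fun i j h => by
    have : Fin.append K J (Fin.castAdd m i) = Fin.append K J (Fin.castAdd m j) := by simpa using h
    exact Fin.castAdd_injective k m (hKJ this)
  rw [hodgeStar_apply vol a he]
  have h : ∑ σ : Equiv.Perm (Fin k), a (e ∘ K) * vol (e ∘ Fin.append K J) =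
      ∑ I : Fin k → Fin (k + m), a (e ∘ I) * vol (Fin.append (e ∘ I) (e ∘ J)) := by
    refine Fintype.sum_of_injective (fun σ : Equiv.Perm (Fin k) => K ∘ σ) ?_ _ _ ?_ ?_
    · intro σ τ hστ
      exact DFunLike.coe_injective (hK.comp_left hστ)
    · intro I hI
      rw [happ]
      by_cases hIJ : Function.Injective (Fin.append I J)
      · exfalso
        apply hI
        -- both `I` and `K` enumerate the complement of the range of `J`
        have hsub : ∀ i, ∃ l, K l = I i := by
          intro i
          obtain ⟨j, hj⟩ := (Finite.injective_iff_surjective.1 hKJ) (I i)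
          induction j using Fin.addCases with
          | left l => exact ⟨l, by simpa using hj⟩
          | right l =>
            have : Fin.append I J (Fin.natAdd k l) = Fin.append I J (Fin.castAdd m i) := by
              simpa using hj
            have := congrArg Fin.val (hIJ this)
            simp at this
            omega
        choose s hs using hsub
        have hsinj : Function.Injective s := fun i j h => by
          have : Fin.append I J (Fin.castAdd m i) = Fin.append I J (Fin.castAdd m j) := by
            simp [← hs, h]
          exact Fin.castAdd_injective k m (hIJ this)
        exact ⟨Equiv.ofBijective s (Finite.injective_iff_bijective.1 hsinj), funext hs⟩
      · rw [vol.map_eq_zero_of_not_injective _ fun h => hIJ (Function.Injective.of_comp h),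
          mul_zero]
    · intro σ
      have hσ : Fin.append (K ∘ σ) J = Fin.append K J ∘
          finSumFinEquiv.permCongr (Equiv.Perm.sumCongr σ 1) := by
        funext i
        refine Fin.addCases (fun l => ?_) (fun l => ?_) i <;> simp
      rw [happ, hσ, ← Function.comp_assoc, ← Function.comp_assoc]
      have h1 := a.toAlternatingMap.map_perm (e ∘ K) σ
      have h2 := vol.toAlternatingMap.map_perm (e ∘ Fin.append K J)
        (finSumFinEquiv.permCongr (Equiv.Perm.sumCongr σ 1))
      simp only [Equiv.Perm.sign_permCongr, Equiv.Perm.sign_sumCongr, Equiv.Perm.sign_one,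
        mul_one, Units.smul_def, zsmul_eq_mul] at h1 h2
      refine Eq.trans ?_ (congrArg₂ (· * ·) h1 h2).symm
      rcases Int.units_eq_one_or (Equiv.Perm.sign σ) with h | h <;> simp [h]
  rw [← h, ← hvol]
  simp only [Finset.sum_const, Finset.card_univ, Fintype.card_perm, Fintype.card_fin,
    nsmul_eq_mul]
  field_simp

/-- The behaviour of the Hodge star under a homothety of the metric. -/
theorem hodgeStar_scale {k m : ℕ} {g : LinearMap.BilinForm ℝ V}
    (vol : V [⋀^Fin (k + m)]→L[ℝ] ℝ) (a : V [⋀^Fin k]→L[ℝ] ℝ)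
    {e : Module.Basis (Fin (k + m)) ℝ V} (he : ∀ i j, g (e i) (e j) = if i = j then 1 else 0)
    {A : ℝ} (hA : A ≠ 0) (B : ℝ) :
    hodgeStar (A ^ 2 • g) (B • vol) a = (B * (A⁻¹) ^ (2 * k)) • hodgeStar g vol a := by
  ext v
  let e' : Module.Basis (Fin (k + m)) ℝ V := e.unitsSMul fun _ => (Units.mk0 A hA)⁻¹
  have he'1 : ∀ i, e' i = A⁻¹ • e i := fun i => by
    simp [e', Module.Basis.unitsSMul_apply, Units.smul_def]
  have he' : ∀ i j, (A ^ 2 • g) (e' i) (e' j) = if i = j then 1 else 0 := by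
    intro i j
    simp only [he'1, LinearMap.smul_apply, map_smul, he, smul_eq_mul]
    split_ifs <;> field_simp
  rw [hodgeStar_apply _ a he', ContinuousAlternatingMap.smul_apply, hodgeStar_apply _ a he,
    smul_eq_mul, Finset.mul_sum, Finset.mul_sum, Finset.mul_sum]
  refine Finset.sum_congr rfl fun I _ => ?_
  have hI : e' ∘ I = fun l => A⁻¹ • (e ∘ I) l := funext fun l => he'1 _
  have h1 : a (e' ∘ I) = (A⁻¹) ^ k * a (e ∘ I) := by
    rw [hI]
    have := a.toMultilinearMap.map_smul_univ (fun _ => A⁻¹) (e ∘ I)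
    simpa using this
  have h2 : vol (Fin.append (e' ∘ I) v) = (A⁻¹) ^ k * vol (Fin.append (e ∘ I) v) := by
    rw [hI]
    have := (insertLast vol v).map_smul_univ (fun _ => A⁻¹) (e ∘ I)
    simpa [insertLast] using this
  rw [h1, ContinuousAlternatingMap.smul_apply, h2, smul_eq_mul]
  ring

theorem hodgeStar_smul {k m : ℕ} {g : LinearMap.BilinForm ℝ V}
    (vol : V [⋀^Fin (k + m)]→L[ℝ] ℝ) (c : ℝ) (a : V [⋀^Fin k]→L[ℝ] ℝ) :
    hodgeStar g vol (c • a) = c • hodgeStar g vol a := by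
  unfold hodgeStar
  split_ifs
  · rw [smul_comm c]
    congr 1
    rw [Finset.smul_sum]
    simp only [ContinuousAlternatingMap.smul_apply, smul_eq_mul, mul_smul]
  · simp

end Hodge

/-! ### The structure constants of the octonions -/

/-- The matrix of left multiplication by the `i`-th imaginary unit of the octonions. The octonions
are a twisted group algebra of `(ℤ/2)³`, that is, `e_a e_b = ± e_{a xor b}`, and the binary digits
of the numeral list the signs. -/
def gammaInt (i : Fin 7) (a b : Fin 8) : ℤ :=
  if a.val ^^^ b.val = i.val + 1 then
    if Nat.testBit 3649057441181095166 (8 * a.val + b.val) then -1 else 1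
  else 0

/-- A sum of seven integers, in a form that evaluates quickly. -/
def sumSeven (f : Fin 7 → ℤ) : ℤ := f 0 + f 1 + f 2 + f 3 + f 4 + f 5 + f 6

theorem sumSeven_eq (f : Fin 7 → ℤ) : sumSeven f = ∑ i, f i := (Fin.sum_univ_seven f).symm

/-- Three times the coefficients of the Cayley 4-form. -/
def cayleyInt (a b c d : Fin 8) : ℤ :=
  sumSeven fun i => gammaInt i a b * gammaInt i c d - gammaInt i a c * gammaInt i b d +
    gammaInt i a d * gammaInt i b c

/-- The coefficients `⟨e_i e_j, e_k⟩` of the associative 3-form; the sign comes from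
`⟨e_i e_j, e_k⟩ = -⟨e_j, e_i e_k⟩`. -/
def assocInt (i j k : Fin 7) : ℤ := -gammaInt i j.succ k.succ

theorem cayleyInt_zero (i j k : Fin 7) : cayleyInt 0 i.succ j.succ k.succ = 3 * assocInt i j k := by
  revert i j k
  decide +kernel

/-- The associative form and the coassociative form (the Cayley form on imaginary octonions) have
complementary coefficients. -/
theorem exists_compl_three (a b c d : Fin 7) : a < b → b < c → c < d →
    ∃ i, (i ≠ a ∧ i ≠ b ∧ i ≠ c ∧ i ≠ d) ∧ ∃ j, (i < j ∧ j ≠ a ∧ j ≠ b ∧ j ≠ c ∧ j ≠ d) ∧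
      ∃ k, (j < k ∧ k ≠ a ∧ k ≠ b ∧ k ≠ c ∧ k ≠ d) ∧
        leviCivita (Fin.append ![i, j, k] ![a, b, c, d]) ≠ 0 ∧
        3 * (assocInt i j k * leviCivita (Fin.append ![i, j, k] ![a, b, c, d])) =
          cayleyInt a.succ b.succ c.succ d.succ := by
  revert a b c d
  decide +kernel

theorem exists_compl_four (i j k : Fin 7) : i < j → j < k →
    ∃ a, (a ≠ i ∧ a ≠ j ∧ a ≠ k) ∧ ∃ b, (a < b ∧ b ≠ i ∧ b ≠ j ∧ b ≠ k) ∧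
      ∃ c, (b < c ∧ c ≠ i ∧ c ≠ j ∧ c ≠ k) ∧ ∃ d, (c < d ∧ d ≠ i ∧ d ≠ j ∧ d ≠ k) ∧
        leviCivita (Fin.append ![a, b, c, d] ![i, j, k]) ≠ 0 ∧
        cayleyInt a.succ b.succ c.succ d.succ *
          leviCivita (Fin.append ![a, b, c, d] ![i, j, k]) = 3 * assocInt i j k := by
  revert i j k
  decide +kernel

/-- The contraction identity behind `(1/6) ι_X φ ∧ ι_Y φ ∧ φ = g(X, Y) vol`. -/
theorem sum_assoc_assoc_cayley (x y : Fin 7) :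
    (sumSeven fun a => sumSeven fun b => if assocInt x a b = 0 then 0 else
      sumSeven fun c => sumSeven fun d => if assocInt y c d = 0 then 0 else
        assocInt x a b * assocInt y c d * cayleyInt a.succ b.succ c.succ d.succ) =
      if x = y then 72 else 0 := by
  revert x y
  decide +kernel

/-! ### Positive 3-forms -/

section Positive

variable {V : Type*} [AddCommGroup V] [Module ℝ V] [TopologicalSpace V]

/-- A basis in which `φ` and `ψ` have the standard coefficients of the associative 3-form and the
coassociative 4-form of `Im 𝕆`. -/
structure IsG2Frame (e : Module.Basis (Fin 7) ℝ V) (φ : V [⋀^Fin 3]→L[ℝ] ℝ)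
    (ψ : V [⋀^Fin 4]→L[ℝ] ℝ) : Prop where
  assoc : ∀ i j k, φ ![e i, e j, e k] = assocInt i j k
  coassoc : ∀ a b c d, 3 * ψ ![e a, e b, e c, e d] = cayleyInt a.succ b.succ c.succ d.succ

theorem tuple_three {α : Type*} (J : Fin 3 → α) : J = ![J 0, J 1, J 2] := by
  funext i; fin_cases i <;> rfl

theorem tuple_four {α : Type*} (J : Fin 4 → α) : J = ![J 0, J 1, J 2, J 3] := by
  funext i; fin_cases i <;> rfl

theorem comp_three {α β : Type*} (e : α → β) (i j k : α) : e ∘ ![i, j, k] = ![e i, e j, e k] := by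
  funext l; fin_cases l <;> rfl

theorem comp_four {α β : Type*} (e : α → β) (a b c d : α) :
    e ∘ ![a, b, c, d] = ![e a, e b, e c, e d] := by
  funext l; fin_cases l <;> rfl

variable {e : Module.Basis (Fin 7) ℝ V} {φ : V [⋀^Fin 3]→L[ℝ] ℝ} {ψ : V [⋀^Fin 4]→L[ℝ] ℝ}
  {g : LinearMap.BilinForm ℝ V} {vol : V [⋀^Fin 7]→L[ℝ] ℝ}

theorem IsG2Frame.hodgeStar_assoc (h : IsG2Frame e φ ψ)
    (he : ∀ i j, g (e i) (e j) = if i = j then 1 else 0) (hvol : vol e = 1) :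
    hodgeStar (k := 3) (m := 4) g vol φ = ψ := by
  apply ContinuousAlternatingMap.toAlternatingMap_injective
  refine alternating_ext_strictMono e fun J hJ => ?_
  obtain ⟨i, -, j, -, k, -, hne, heq⟩ := exists_compl_three (J 0) (J 1) (J 2) (J 3)
    (hJ (by decide)) (hJ (by decide)) (hJ (by decide))
  rw [tuple_four J]
  have h1 := hodgeStar_apply_compl (k := 3) (m := 4) vol φ he ![i, j, k] ![J 0, J 1, J 2, J 3]
    (injective_of_leviCivita_ne_zero hne)
  refine h1.trans ?_
  rw [hvol, comp_three, h.assoc, mul_one]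
  have h2 := h.coassoc (J 0) (J 1) (J 2) (J 3)
  rw [← heq] at h2
  push_cast at h2
  have h3 : ψ.toAlternatingMap (e ∘ ![J 0, J 1, J 2, J 3]) =
    ψ ![e (J 0), e (J 1), e (J 2), e (J 3)] := by rw [comp_four]; rfl
  rw [h3]
  linarith

theorem IsG2Frame.hodgeStar_coassoc (h : IsG2Frame e φ ψ)
    (he : ∀ i j, g (e i) (e j) = if i = j then 1 else 0) (hvol : vol e = 1) :
    hodgeStar (k := 4) (m := 3) g vol ψ = φ := by
  apply ContinuousAlternatingMap.toAlternatingMap_injective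
  refine alternating_ext_strictMono e fun J hJ => ?_
  obtain ⟨a, -, b, -, c, -, d, -, hne, heq⟩ := exists_compl_four (J 0) (J 1) (J 2)
    (hJ (by decide)) (hJ (by decide))
  rw [tuple_three J]
  have h1 := hodgeStar_apply_compl (k := 4) (m := 3) vol ψ he ![a, b, c, d] ![J 0, J 1, J 2]
    (injective_of_leviCivita_ne_zero hne)
  refine h1.trans ?_
  have h2 := h.coassoc a b c d
  have h3 : φ.toAlternatingMap (e ∘ ![J 0, J 1, J 2]) = assocInt (J 0) (J 1) (J 2) := by
    rw [comp_three]; exact h.assoc _ _ _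
  have h4 := congrArg (Int.cast : ℤ → ℝ) heq
  push_cast at h4
  rw [hvol, comp_four, h3]
  rw [← h2] at h4
  linarith

/-- The volume form inverts the sum over complementary triples. -/
theorem IsG2Frame.sum_assoc_mul_vol (h : IsG2Frame e φ ψ)
    (he : ∀ i j, g (e i) (e j) = if i = j then 1 else 0) (hvol : vol e = 1) (J : Fin 4 → Fin 7) :
    ∑ K : Fin 3 → Fin 7, φ (e ∘ K) * vol (e ∘ (Fin.append J K : Fin (4 + 3) → Fin 7)) =
      6 * ψ (e ∘ J) := by
  have h1 := hodgeStar_apply (k := 3) (m := 4) vol φ he (e ∘ J)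
  rw [h.hodgeStar_assoc he hvol] at h1
  rw [h1, ← mul_assoc]
  norm_num [Nat.factorial]
  refine Finset.sum_congr rfl fun K _ => ?_
  congr 1
  let σ : Equiv.Perm (Fin 7) := (finAddFlip : Fin (4 + 3) ≃ Fin (3 + 4))
  have hσ : Equiv.Perm.sign σ = 1 := by decide
  have h2 := vol.toAlternatingMap.map_perm (Fin.append (e ∘ K) (e ∘ J) : Fin (3 + 4) → V) σ
  rw [hσ, one_smul] at h2
  refine Eq.trans (congrArg vol ?_) h2
  funext i
  refine Fin.addCases (m := 4) (n := 3) (fun l => ?_) (fun l => ?_) i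
  · exact (congrArg e (Fin.append_left J K l)).trans
      ((congrArg (Fin.append (e ∘ K) (e ∘ J)) (finAddFlip_apply_castAdd l 3)).trans
        (Fin.append_right _ _ l)).symm
  · exact (congrArg e (Fin.append_right J K l)).trans
      ((congrArg (Fin.append (e ∘ K) (e ∘ J)) (finAddFlip_apply_natAdd l 4)).trans
        (Fin.append_left _ _ l)).symm

theorem sum_four {α M : Type*} [Fintype α] [AddCommMonoid M] (f : α → α → α → α → M) :
    ∑ J : Fin 4 → α, f (J 0) (J 1) (J 2) (J 3) = ∑ a, ∑ b, ∑ c, ∑ d, f a b c d := by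
  simp_rw [← Fintype.sum_prod_type']
  exact Fintype.sum_equiv (M := M)
    ({  toFun := fun J => (J 0, J 1, J 2, J 3)
        invFun := fun p => ![p.1, p.2.1, p.2.2.1, p.2.2.2]
        left_inv := fun J => (tuple_four J).symm
        right_inv := fun _ => rfl } : (Fin 4 → α) ≃ α × α × α × α) _ _ fun _ => rfl

theorem sum_assocInt_mul (x y : Fin 7) :
    ∑ J : Fin 4 → Fin 7, assocInt x (J 0) (J 1) * assocInt y (J 2) (J 3) *
      cayleyInt (J 0).succ (J 1).succ (J 2).succ (J 3).succ = if x = y then 72 else 0 := by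
  rw [sum_four fun a b c d => assocInt x a b * assocInt y c d *
    cayleyInt a.succ b.succ c.succ d.succ, ← sum_assoc_assoc_cayley]
  simp only [sumSeven_eq]
  refine Finset.sum_congr rfl fun a _ => Finset.sum_congr rfl fun b _ => ?_
  split_ifs with h1
  · simp [h1]
  · refine Finset.sum_congr rfl fun c _ => Finset.sum_congr rfl fun d _ => ?_
    split_ifs with h2
    · simp [h2]
    · rfl

theorem IsG2Frame.interior_apply (h : IsG2Frame e φ ψ) (X : V) (a b : Fin 7) :
    interior X φ ![e a, e b] = ∑ x, e.repr X x * assocInt x a b := by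
  let f : V →ₗ[ℝ] ℝ :=
    { toFun := fun Z => interior Z φ ![e a, e b]
      map_add' := fun Z W => by simp [interior]
      map_smul' := fun r Z => by simp [interior] }
  have hf : f X = ∑ x, e.repr X x * f (e x) := by
    conv_lhs => rw [← e.sum_repr X]
    simp only [map_sum, map_smul, smul_eq_mul]
  refine hf.trans (Finset.sum_congr rfl fun x _ => ?_)
  rw [← h.assoc]
  rfl

theorem IsG2Frame.sum_interior_mul (h : IsG2Frame e φ ψ) (X Y : V) :
    ∑ J : Fin 4 → Fin 7, ψ (e ∘ J) * (interior X φ (e ∘ J ∘ Fin.castAdd 2) *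
      interior Y φ (e ∘ J ∘ Fin.natAdd 2)) = 24 * ∑ i, e.repr X i * e.repr Y i := by
  have h1 : ∀ J : Fin 4 → Fin 7, 3 * (ψ (e ∘ J) * (interior X φ (e ∘ J ∘ Fin.castAdd 2) *
      interior Y φ (e ∘ J ∘ Fin.natAdd 2))) = ∑ x, ∑ y, (e.repr X x * e.repr Y y) *
        ((assocInt x (J 0) (J 1) * assocInt y (J 2) (J 3) *
          cayleyInt (J 0).succ (J 1).succ (J 2).succ (J 3).succ : ℤ) : ℝ) := by
    intro J
    have hJ1 : e ∘ J ∘ Fin.castAdd 2 = ![e (J 0), e (J 1)] := by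
      funext l; fin_cases l <;> rfl
    have hJ2 : e ∘ J ∘ Fin.natAdd 2 = ![e (J 2), e (J 3)] := by
      funext l; fin_cases l <;> rfl
    have hJ3 : e ∘ J = ![e (J 0), e (J 1), e (J 2), e (J 3)] := by
      funext l; fin_cases l <;> rfl
    rw [hJ1, hJ2, h.interior_apply, h.interior_apply, ← mul_assoc, hJ3, h.coassoc,
      Finset.sum_mul_sum, Finset.mul_sum]
    refine Finset.sum_congr rfl fun x _ => ?_
    rw [Finset.mul_sum]
    refine Finset.sum_congr rfl fun y _ => ?_
    push_cast
    ring
  have h2 : 3 * ∑ J : Fin 4 → Fin 7, ψ (e ∘ J) * (interior X φ (e ∘ J ∘ Fin.castAdd 2) *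
      interior Y φ (e ∘ J ∘ Fin.natAdd 2)) = 72 * ∑ i, e.repr X i * e.repr Y i := by
    rw [Finset.mul_sum, Finset.sum_congr rfl fun J _ => h1 J, Finset.sum_comm, Finset.mul_sum]
    refine Finset.sum_congr rfl fun x _ => ?_
    rw [Finset.sum_comm]
    simp_rw [← Finset.mul_sum, ← Int.cast_sum, sum_assocInt_mul]
    simp
    ring
  linarith

theorem wedge_four_three_apply (hvol : vol e = 1) (α : V [⋀^Fin 4]→ₗ[ℝ] ℝ)
    (β : V [⋀^Fin 3]→ₗ[ℝ] ℝ) :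
    144 * wedge α β e = ∑ J : Fin 4 → Fin 7, α (e ∘ J) * ∑ K : Fin 3 → Fin 7,
      β (e ∘ K) * vol (e ∘ (Fin.append J K : Fin (4 + 3) → Fin 7)) := by
  have h1 := sum_mul_wedge (p := 4) (q := 3) e vol.toAlternatingMap α β
  have h2 : ∀ η : V [⋀^Fin (4 + 3)]→ₗ[ℝ] ℝ,
      ∑ I : Fin (4 + 3) → Fin 7, vol.toAlternatingMap (e ∘ I) * η (e ∘ I) =
        (Nat.factorial 7 : ℕ) * (vol e * η e) := fun η => sum_mul_top e vol.toAlternatingMap η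
  have f3 : ((Nat.factorial 3 : ℕ) : ℝ) = 6 := by norm_num [Nat.factorial]
  have f4 : ((Nat.factorial 4 : ℕ) : ℝ) = 24 := by norm_num [Nat.factorial]
  have f7 : ((Nat.factorial 7 : ℕ) : ℝ) = 5040 := by norm_num [Nat.factorial]
  have f7' : ((Nat.factorial (4 + 3) : ℕ) : ℝ) = 5040 := by norm_num [Nat.factorial]
  rw [f4, f3, f7'] at h1
  rw [f7] at h2
  have h3 : ∑ I : Fin (4 + 3) → Fin 7, vol.toAlternatingMap (e ∘ I) *
        (α (e ∘ I ∘ Fin.castAdd 3) * β (e ∘ I ∘ Fin.natAdd 4)) =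
      ∑ J : Fin 4 → Fin 7, α (e ∘ J) * ∑ K : Fin 3 → Fin 7,
        β (e ∘ K) * vol (e ∘ (Fin.append J K : Fin (4 + 3) → Fin 7)) := by
    rw [← (Fin.appendEquiv 4 3).sum_comp, Fintype.sum_prod_type]
    refine Finset.sum_congr rfl fun J _ => ?_
    rw [Finset.mul_sum]
    refine Finset.sum_congr rfl fun K _ => ?_
    have hJ : (Fin.append J K : Fin (4 + 3) → Fin 7) ∘ Fin.castAdd 3 = J := by
      funext i; simp
    have hK : (Fin.append J K : Fin (4 + 3) → Fin 7) ∘ Fin.natAdd 4 = K := by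
      funext i; simp
    simp only [Fin.appendEquiv, Equiv.coe_fn_mk, hJ, hK,
      ContinuousAlternatingMap.coe_toAlternatingMap]
    ring
  rw [h3] at h1
  have key : ∀ t w s s' b : ℝ, t = 1 → s = 5040 * (t * w) → (24 * 6 : ℝ) * s' = 5040 * b →
      s = s' → 144 * w = b := by
    intro t w s s' b ht h4 h5 h6
    subst ht h6
    linarith
  exact key _ _ _ _ _ hvol (h2 _) h1 rfl

/-- The associative 3-form induces the inner product and the orientation of its frame. -/
theorem IsG2Frame.induces (h : IsG2Frame e φ ψ)
    (he : ∀ i j, g (e i) (e j) = if i = j then 1 else 0) (hvol : vol e = 1) :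
    Induces φ g vol := by
  have hg : ∀ X Y, g X Y = ∑ i, e.repr X i * e.repr Y i := by
    intro X Y
    conv_lhs => rw [← e.sum_repr X, ← e.sum_repr Y]
    simp only [map_sum, map_smul, LinearMap.sum_apply, LinearMap.smul_apply, he, smul_eq_mul,
      mul_ite, mul_one, mul_zero, Finset.sum_ite_eq', Finset.mem_univ, if_true]
    exact Finset.sum_congr rfl fun _ _ => by ring
  refine ⟨fun X Y => ?_, fun X hX => ?_, fun v => ?_, fun X Y => ?_⟩
  · rw [hg, hg]
    exact Finset.sum_congr rfl fun _ _ => by ring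
  · rw [hg]
    obtain ⟨i, hi⟩ : ∃ i, e.repr X i ≠ 0 := by
      by_contra hc
      push Not at hc
      exact hX (e.repr.map_eq_zero_iff.1 (Finsupp.ext hc))
    exact Finset.sum_pos' (fun i _ => mul_self_nonneg _)
      ⟨i, Finset.mem_univ i, mul_self_pos.2 hi⟩
  · have h1 := vol.toAlternatingMap.eq_smul_basis_det e
    have h2 : vol v = e.det v := by
      have := congrArg (fun f => f v) h1
      simpa [hvol] using this
    have h3 : (Matrix.of fun i j => g (v i) (v j)) = (e.toMatrix v).transpose * e.toMatrix v := by
      ext i j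
      simp [hg, Matrix.mul_apply, Module.Basis.toMatrix_apply]
    rw [h2, h3, Matrix.det_mul, Matrix.det_transpose, Module.Basis.det_apply, sq]
  · -- the degrees `2 + 2` and `4`, and `4 + 3` and `7`, agree only by computation; quantifying over
    -- `α` and `η` lets this conversion happen on variables
    have h1 : ∀ α : V [⋀^Fin (2 + 2)]→ₗ[ℝ] ℝ,
        (2 * 2 : ℝ) * ∑ J : Fin (2 + 2) → Fin 7, ψ.toAlternatingMap (e ∘ J) * α (e ∘ J) =
          24 * (24 * g X Y) →
        (1 / 6 : ℝ) • wedge α φ.toAlternatingMap = g X Y • vol.toAlternatingMap := by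
      intro α hα
      have h2 := wedge_four_three_apply hvol α φ.toAlternatingMap
      have h3 : ∀ J : Fin 4 → Fin 7, ∑ K : Fin 3 → Fin 7, φ.toAlternatingMap (e ∘ K) *
          vol (e ∘ (Fin.append J K : Fin (4 + 3) → Fin 7)) = 6 * ψ.toAlternatingMap (e ∘ J) :=
        h.sum_assoc_mul_vol he hvol
      simp_rw [h3] at h2
      have h4 : ∑ J : Fin 4 → Fin 7, α (e ∘ J) * (6 * ψ.toAlternatingMap (e ∘ J)) =
          6 * ∑ J : Fin (2 + 2) → Fin 7, ψ.toAlternatingMap (e ∘ J) * α (e ∘ J) := by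
        rw [Finset.mul_sum]
        exact Finset.sum_congr rfl fun J _ => by ring
      have key : ∀ w a s c : ℝ, 144 * w = a → a = 6 * s → (2 * 2 : ℝ) * s = 24 * (24 * c) →
          w = 6 * c := by
        intro w a s c h5 h6 h7
        linarith
      have h5 := key _ _ _ _ h2 h4 hα
      have h6 : ∀ (r c : ℝ) (η : V [⋀^Fin 7]→ₗ[ℝ] ℝ), r * η e = c →
          r • η = c • vol.toAlternatingMap := by
        intro r c η hη
        have hrhs : (c • vol.toAlternatingMap) e = c := by
          rw [AlternatingMap.smul_apply, ContinuousAlternatingMap.coe_toAlternatingMap, hvol,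
            smul_eq_mul, mul_one]
        rw [AlternatingMap.eq_smul_basis_det e (r • η),
          AlternatingMap.eq_smul_basis_det e (c • vol.toAlternatingMap), hrhs,
          AlternatingMap.smul_apply, smul_eq_mul, hη]
      have h7 : ∀ (r c : ℝ) (η : V [⋀^Fin (4 + 3)]→ₗ[ℝ] ℝ), r * η e = c →
          r • η = c • vol.toAlternatingMap := h6
      exact h7 _ _ _ (by rw [h5]; ring)
    have h2 := sum_mul_wedge (p := 2) (q := 2) e ψ.toAlternatingMap (interior X φ) (interior Y φ)
    have f2 : ((Nat.factorial 2 : ℕ) : ℝ) = 2 := by norm_num [Nat.factorial]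
    have f4 : ((Nat.factorial (2 + 2) : ℕ) : ℝ) = 24 := by norm_num [Nat.factorial]
    rw [f2, f4] at h2
    refine h1 _ (h2.trans ?_)
    rw [hg]
    exact congrArg _ (h.sum_interior_mul X Y)

end Positive

section Induced

variable {V : Type*} [AddCommGroup V] [Module ℝ V] [TopologicalSpace V]
  {φ : V [⋀^Fin 3]→L[ℝ] ℝ} {g g' : LinearMap.BilinForm ℝ V} {vol vol' : V [⋀^Fin 7]→L[ℝ] ℝ}

theorem Induces.vol_ne_zero (h : Induces φ g vol) (e : Module.Basis (Fin 7) ℝ V) :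
    vol e ≠ 0 := by
  intro h0
  have h1 := h.vol_sq e
  rw [h0, zero_pow two_ne_zero] at h1
  obtain ⟨c, hc, hc0⟩ := Matrix.exists_mulVec_eq_zero_iff.2 h1.symm
  have hX : (∑ i, c i • e i) ≠ 0 := by
    intro hX
    apply hc
    funext i
    exact Fintype.linearIndependent_iff.1 e.linearIndependent c hX i
  refine (h.pos _ hX).ne' ?_
  have h2 : ∀ i, g (e i) (∑ j, c j • e j) = 0 := by
    intro i
    have := congrFun hc0 i
    simp only [Matrix.mulVec, dotProduct, Matrix.of_apply, Pi.zero_apply] at this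
    simp only [map_sum, map_smul, smul_eq_mul, ← this]
    exact Finset.sum_congr rfl fun _ _ => mul_comm _ _
  rw [map_sum]
  exact Finset.sum_eq_zero fun i _ => by rw [map_smul, h.symm, h2, smul_zero]

/-- The inner product and the volume form induced by a positive 3-form are unique: they are
determined up to a factor by the equation, and `vol = ± √(det g)` makes the ninth power of this
factor equal to `1`. -/
theorem Induces.unique (e : Module.Basis (Fin 7) ℝ V) (h : Induces φ g vol)
    (h' : Induces φ g' vol') : g' = g ∧ vol' = vol := by
  have key : ∀ X Y, ∀ v, g X Y * vol v = g' X Y * vol' v := by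
    intro X Y v
    have := (h.eqn X Y).symm.trans (h'.eqn X Y)
    exact congrArg (fun f : V [⋀^Fin 7]→ₗ[ℝ] ℝ => f v) this
  have hp := h.pos _ (e.ne_zero 0)
  have hp' := h'.pos _ (e.ne_zero 0)
  obtain ⟨c, hc⟩ : ∃ c, c = g (e 0) (e 0) / g' (e 0) (e 0) := ⟨_, rfl⟩
  have hcpos : 0 < c := hc ▸ div_pos hp hp'
  have hvol : ∀ v, vol' v = c * vol v := by
    intro v
    rw [hc]
    field_simp
    linarith [key (e 0) (e 0) v]
  have hv := h.vol_ne_zero e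
  have hg : ∀ X Y, g X Y = c * g' X Y := by
    intro X Y
    have := key X Y e
    rw [hvol] at this
    exact mul_right_cancel₀ hv (by linarith)
  have hdet : (Matrix.of fun i j => g (e i) (e j)) =
      c • (Matrix.of fun i j => g' (e i) (e j) : Matrix (Fin 7) (Fin 7) ℝ) := by
    ext i j
    simp [hg]
  have h1 := h.vol_sq e
  rw [hdet, Matrix.det_smul, ← h'.vol_sq e, hvol, Fintype.card_fin] at h1
  have h9 : c ^ 9 = 1 := by
    have : (c ^ 9 - 1) * vol e ^ 2 = 0 := by linear_combination -h1
    rcases mul_eq_zero.1 this with h2 | h2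
    · linarith
    · exact absurd (pow_eq_zero_iff two_ne_zero |>.1 h2) hv
  have hc1 : c = 1 := (pow_eq_one_iff_of_nonneg hcpos.le (by norm_num)).1 h9
  subst hc1
  constructor
  · ext X Y
    rw [hg, one_mul]
  · ext v
    rw [hvol, one_mul]

theorem Induces.induced_eq (e : Module.Basis (Fin 7) ℝ V) (h : Induces φ g vol) :
    inducedMetric φ = g ∧ inducedVol φ = vol := by
  have hpos : IsPositive φ := ⟨(g, vol), h⟩
  have h1 : induced φ = hpos.choose := by rw [induced, dif_pos hpos]
  have h2 := h.unique e hpos.choose_spec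
  exact ⟨(congrArg Prod.fst h1).trans h2.1, (congrArg Prod.snd h1).trans h2.2⟩

theorem wedge_smul_smul {p q : ℕ} (r s : ℝ) (a : V [⋀^Fin p]→ₗ[ℝ] ℝ) (b : V [⋀^Fin q]→ₗ[ℝ] ℝ) :
    wedge (r • a) (s • b) = (r * s) • wedge a b := by
  ext v
  have h1 := wedge_apply (r • a) (s • b) v
  have h2 := wedge_apply a b v
  have h3 : (p.factorial * q.factorial : ℝ) ≠ 0 := by positivity
  apply mul_left_cancel₀ h3
  rw [h1, AlternatingMap.smul_apply, smul_eq_mul, mul_left_comm, h2, Finset.mul_sum]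
  refine Finset.sum_congr rfl fun σ _ => ?_
  simp only [AlternatingMap.smul_apply, smul_eq_mul]
  ring

theorem smul_wedge_wedge {X Y : V} {c : ℝ} (u r s c' : ℝ)
    (h : u • wedge (wedge (interior X φ) (interior Y φ)) φ.toAlternatingMap =
      c • vol.toAlternatingMap) (hc : s * c' = r * r * r * c) :
    u • wedge (wedge (interior X (r • φ)) (interior Y (r • φ))) (r • φ).toAlternatingMap =
      c' • (s • vol).toAlternatingMap := by
  have h1 : wedge (wedge (interior X (r • φ)) (interior Y (r • φ))) (r • φ).toAlternatingMap =
      (r * r * r) • wedge (wedge (interior X φ) (interior Y φ)) φ.toAlternatingMap := by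
    have h2 := wedge_smul_smul (r * r) r (wedge (interior X φ) (interior Y φ)) φ.toAlternatingMap
    rwa [← wedge_smul_smul] at h2
  have h2 : c' • (s • vol).toAlternatingMap = (r * r * r) • (c • vol.toAlternatingMap) := by
    ext v
    simp only [ContinuousAlternatingMap.toAlternatingMap_smul, AlternatingMap.smul_apply,
      smul_eq_mul]
    linear_combination hc * vol.toAlternatingMap v
  rw [h1, smul_comm]
  exact (congrArg (fun η => (r * r * r) • η) h).trans h2.symm

/-- Multiplying a positive 3-form by `A³` multiplies lengths by `A`. -/
theorem Induces.smul (h : Induces φ g vol) {A : ℝ} (hA : A ≠ 0) :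
    Induces (A ^ 3 • φ) (A ^ 2 • g) (A ^ 7 • vol) := by
  have hA2 : 0 < A ^ 2 := by positivity
  refine ⟨fun X Y => ?_, fun X hX => ?_, fun v => ?_, fun X Y => ?_⟩
  · simp [h.symm X Y]
  · simpa using mul_pos hA2 (h.pos X hX)
  · have : (Matrix.of fun i j => (A ^ 2 • g) (v i) (v j)) =
        A ^ 2 • (Matrix.of fun i j => g (v i) (v j) : Matrix (Fin 7) (Fin 7) ℝ) := by
      ext i j
      simp
    rw [this, Matrix.det_smul, ← h.vol_sq, ContinuousAlternatingMap.smul_apply, Fintype.card_fin,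
      smul_eq_mul]
    ring
  · have h1 := h.eqn X Y
    obtain ⟨u, hu⟩ : ∃ u : ℝ, u = 1 / 6 := ⟨_, rfl⟩
    rw [← hu] at h1 ⊢
    have h2 : A ^ 7 * (A ^ 2 • g) X Y = A ^ 3 * A ^ 3 * A ^ 3 * g X Y := by simp; ring
    generalize (A ^ 2 • g) X Y = c' at h2 ⊢
    generalize A ^ 3 = r at h2 ⊢
    generalize A ^ 7 = s at h2 ⊢
    exact smul_wedge_wedge u r s c' h1 h2

theorem wedge_zero {p q : ℕ} (a : V [⋀^Fin p]→ₗ[ℝ] ℝ) :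
    wedge a (0 : V [⋀^Fin q]→ₗ[ℝ] ℝ) = 0 := by
  have h := wedge_smul_smul 1 0 a (0 : V [⋀^Fin q]→ₗ[ℝ] ℝ)
  rwa [smul_zero, one_smul, mul_zero, zero_smul] at h

theorem not_isPositive_zero (e : Module.Basis (Fin 7) ℝ V) :
    ¬ IsPositive (0 : V [⋀^Fin 3]→L[ℝ] ℝ) := by
  rintro ⟨⟨g, vol⟩, h⟩
  have h2 := h.eqn (e 0) (e 0)
  rw [ContinuousAlternatingMap.toAlternatingMap_zero, wedge_zero, smul_zero] at h2
  have h3 : (0 : V [⋀^Fin 7]→ₗ[ℝ] ℝ) = g (e 0) (e 0) • vol.toAlternatingMap := h2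
  have h4 : g (e 0) (e 0) * vol e = 0 := (congrArg (fun f => f e) h3).symm
  exact mul_ne_zero (h.pos _ (e.ne_zero 0)).ne' (h.vol_ne_zero e) h4

end Induced

/-! ### The Cayley form and its invariance under `Spin(7)` -/

/-- The operator on `ℝ⁸` with matrix `M`. -/
abbrev spinorOp (M : Matrix (Fin 8) (Fin 8) ℝ) : E8 →L[ℝ] E8 := Matrix.toEuclideanCLM (𝕜 := ℝ) M

/-- The 2-form `ω_v (a, b) = ⟨a, v b⟩` on spinors, for `v ∈ Im 𝕆`. -/
def spinorPairing (v : Fin 7 → ℝ) (a b : E8) : ℝ := inner ℝ a (spinorOp (cliffordMul v) b)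

theorem inner_spinorOp (M : Matrix (Fin 8) (Fin 8) ℝ) (a b : E8) :
    inner ℝ (spinorOp M a) b = inner ℝ a (spinorOp M.transpose b) := by
  rw [← Matrix.conjTranspose_eq_transpose_of_trivial, ← Matrix.star_eq_conjTranspose, spinorOp,
    spinorOp, map_star, ContinuousLinearMap.star_eq_adjoint,
    ContinuousLinearMap.adjoint_inner_right]

theorem spinorPairing_swap (v : Fin 7 → ℝ) (a b : E8) :
    spinorPairing v b a = -spinorPairing v a b := by
  rw [spinorPairing, spinorPairing, real_inner_comm, inner_spinorOp, cliffordMul_transpose]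
  simp [spinorOp]

theorem spinorPairing_add_left (v : Fin 7 → ℝ) (a a' b : E8) :
    spinorPairing v (a + a') b = spinorPairing v a b + spinorPairing v a' b :=
  inner_add_left _ _ _

theorem spinorPairing_add_right (v : Fin 7 → ℝ) (a b b' : E8) :
    spinorPairing v a (b + b') = spinorPairing v a b + spinorPairing v a b' := by
  rw [spinorPairing, map_add, inner_add_right]; rfl

theorem spinorPairing_smul_left (v : Fin 7 → ℝ) (r : ℝ) (a b : E8) :
    spinorPairing v (r • a) b = r * spinorPairing v a b :=
  real_inner_smul_left _ _ _

theorem spinorPairing_smul_right (v : Fin 7 → ℝ) (r : ℝ) (a b : E8) :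
    spinorPairing v a (r • b) = r * spinorPairing v a b := by
  rw [spinorPairing, map_smul, real_inner_smul_right]; rfl

theorem spinorPairing_sum {ι : Type*} (s : Finset ι) (c : ι → ℝ) (u : ι → Fin 7 → ℝ) (a b : E8) :
    spinorPairing (∑ i ∈ s, c i • u i) a b = ∑ i ∈ s, c i * spinorPairing (u i) a b := by
  simp [spinorPairing, spinorOp, map_sum, inner_sum, real_inner_smul_right]

/-- The `i`-th imaginary unit of the octonions, as a vector of `ℝ⁷`. -/
abbrev unit7 (i : Fin 7) : Fin 7 → ℝ := Pi.single i 1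

/-- The Cayley 4-form `(1/6) ∑ᵢ ωᵢ ∧ ωᵢ` on `ℝ⁸`, where `ωᵢ` runs over the seven 2-forms
`(a, b) ↦ ⟨a, eᵢ b⟩`. -/
def cayleyForm : E8 [⋀^Fin 4]→L[ℝ] ℝ where
  toFun x := (1 / 3 : ℝ) * ∑ i, (spinorPairing (unit7 i) (x 0) (x 1) *
      spinorPairing (unit7 i) (x 2) (x 3) -
    spinorPairing (unit7 i) (x 0) (x 2) * spinorPairing (unit7 i) (x 1) (x 3) +
    spinorPairing (unit7 i) (x 0) (x 3) * spinorPairing (unit7 i) (x 1) (x 2))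
  map_update_add' := by
    intro inst x l a b
    obtain rfl : inst = instDecidableEqFin 4 := Subsingleton.elim _ _
    rw [← mul_add, ← Finset.sum_add_distrib]
    congr 1
    refine Finset.sum_congr rfl fun i _ => ?_
    fin_cases l <;> simp [Function.update, spinorPairing_add_left, spinorPairing_add_right] <;>
      ring
  map_update_smul' := by
    intro inst x l r a
    obtain rfl : inst = instDecidableEqFin 4 := Subsingleton.elim _ _
    rw [smul_eq_mul, mul_left_comm, Finset.mul_sum _ _ r]
    congr 1
    refine Finset.sum_congr rfl fun i _ => ?_
    fin_cases l <;> simp [Function.update, spinorPairing_smul_left, spinorPairing_smul_right] <;>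
      ring
  map_eq_zero_of_eq' := by
    intro x l m hlm hne
    refine mul_eq_zero_of_right _ (Finset.sum_eq_zero fun i _ => ?_)
    have hs : ∀ b c, spinorPairing (unit7 i) (x b) (x c) = -spinorPairing (unit7 i) (x c) (x b) :=
      fun b c => spinorPairing_swap _ _ _
    have he : ∀ b, spinorPairing (unit7 i) (x l) (x b) = spinorPairing (unit7 i) (x m) (x b) :=
      fun b => by rw [hlm]
    generalize spinorPairing (unit7 i) = P at hs he ⊢
    have h0 := he 0
    have h1 := he 1
    have h2 := he 2
    have h3 := he 3
    have h10 := hs 1 0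
    have h20 := hs 2 0
    have h21 := hs 2 1
    have h30 := hs 3 0
    have h31 := hs 3 1
    have h32 := hs 3 2
    have h00 := hs 0 0
    have h11 := hs 1 1
    have h22 := hs 2 2
    have h33 := hs 3 3
    clear he hs hlm
    fin_cases l <;> fin_cases m <;> first
      | exact absurd rfl hne
      | (simp only [Fin.zero_eta, Fin.mk_one, Fin.reduceFinMk] at h0 h1 h2 h3
         grind)
  cont := by
    have h : ∀ (i : Fin 7) (l m : Fin 4),
        Continuous fun x : Fin 4 → E8 => spinorPairing (unit7 i) (x l) (x m) := by
      intro i l m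
      exact (continuous_apply l).inner ((spinorOp _).continuous.comp (continuous_apply m))
    exact continuous_const.mul (continuous_finsetSum _ fun i _ =>
      ((h i 0 1).mul (h i 2 3)).sub ((h i 0 2).mul (h i 1 3)) |>.add ((h i 0 3).mul (h i 1 2)))

theorem cayleyForm_apply (x : Fin 4 → E8) : cayleyForm x =
    (1 / 3 : ℝ) * ∑ i, (spinorPairing (unit7 i) (x 0) (x 1) *
      spinorPairing (unit7 i) (x 2) (x 3) -
    spinorPairing (unit7 i) (x 0) (x 2) * spinorPairing (unit7 i) (x 1) (x 3) +
    spinorPairing (unit7 i) (x 0) (x 3) * spinorPairing (unit7 i) (x 1) (x 2)) := rfl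

/-- The standard basis of `ℝ⁸ = 𝕆`. -/
abbrev unit8 (a : Fin 8) : E8 := EuclideanSpace.single a 1

theorem cliffordMul_unit7 (i : Fin 7) :
    cliffordMul (unit7 i) = (Matrix.of (gammaInt i)).map (Int.cast : ℤ → ℝ) := by
  have h : ∀ v : Fin 7 → ℝ, ∀ a b : Fin 8, cliffordMul v a b = ∑ i, v i * (gammaInt i a b : ℝ) := by
    intro v a b
    have hg : ∀ i, (gammaInt i a b : ℝ) = if a.val ^^^ b.val = i.val + 1 then
        if Nat.testBit 3649057441181095166 (8 * a.val + b.val) then -1 else 1 else 0 := by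
      intro i
      rw [gammaInt]
      split_ifs <;> simp
    simp only [hg, Fin.sum_univ_seven]
    fin_cases a <;> fin_cases b <;> simp [cliffordMul, Nat.testBit]
  ext a b
  rw [h]
  simp [Pi.single_apply]

theorem spinorPairing_unit8 (i : Fin 7) (a b : Fin 8) :
    spinorPairing (unit7 i) (unit8 a) (unit8 b) = gammaInt i a b := by
  rw [spinorPairing, cliffordMul_unit7, EuclideanSpace.inner_single_left, spinorOp]
  simp

theorem cayleyForm_unit8 (a b c d : Fin 8) :
    3 * cayleyForm ![unit8 a, unit8 b, unit8 c, unit8 d] = cayleyInt a b c d := by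
  rw [cayleyForm_apply, cayleyInt, sumSeven_eq]
  push_cast
  simp [spinorPairing_unit8]

theorem Q7_apply (v : Fin 7 → ℝ) : Q7 v = -∑ i, v i * v i := by
  simp [Q7, QuadraticMap.weightedSumSquares_apply]

theorem cliffordMul_mul_add (v w : Fin 7 → ℝ) :
    cliffordMul v * cliffordMul w + cliffordMul w * cliffordMul v =
      (-2 * ∑ i, v i * w i) • (1 : Matrix (Fin 8) (Fin 8) ℝ) := by
  have h1 := cliffordMul_mul_self (v + w)
  have h2 : Q7 (v + w) = Q7 v + Q7 w + -2 * ∑ i, v i * w i := by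
    simp only [Q7_apply, Pi.add_apply, Finset.mul_sum, ← Finset.sum_neg_distrib,
      ← Finset.sum_add_distrib]
    exact Finset.sum_congr rfl fun _ _ => by ring
  rw [h2, map_add, map_add, map_add, ← cliffordMul_mul_self, ← cliffordMul_mul_self,
    Algebra.algebraMap_eq_smul_one, add_mul, mul_add, mul_add] at h1
  rw [← sub_eq_zero] at h1 ⊢
  rw [← h1]
  abel

theorem spinorRep_ι (v : Fin 7 → ℝ) :
    spinorRep (CliffordAlgebra.ι Q7 v) = cliffordMul v := by
  rw [spinorRep, CliffordAlgebra.lift_ι_apply]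

theorem transpose_spinorRep_mul_self (s : spinGroup Q7) :
    (spinorRep (s : CliffordAlgebra Q7)).transpose * spinorRep (s : CliffordAlgebra Q7) = 1 := by
  rw [← Matrix.conjTranspose_eq_transpose_of_trivial, ← Matrix.star_eq_conjTranspose,
    ← spinorRep_star, ← map_mul, spinGroup.star_mul_self_of_mem s.2, map_one]

/-- Conjugation by an element of `Spin(7)` preserves the imaginary octonions. -/
theorem exists_conj_cliffordMul (s : spinGroup Q7) (v : Fin 7 → ℝ) : ∃ w,
    (spinorRep (s : CliffordAlgebra Q7)).transpose * cliffordMul v *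
      spinorRep (s : CliffordAlgebra Q7) = cliffordMul w := by
  let x : (CliffordAlgebra Q7)ˣ :=
    ⟨star (s : CliffordAlgebra Q7), s, spinGroup.star_mul_self_of_mem s.2,
      spinGroup.mul_star_self_of_mem s.2⟩
  have hx : (x : CliffordAlgebra Q7) ∈ spinGroup Q7 := spinGroup.star_mem s.2
  obtain ⟨w, hw⟩ := spinGroup.conjAct_smul_ι_mem_range_ι hx v
  refine ⟨w, ?_⟩
  rw [ConjAct.units_smul_def] at hw
  have := congrArg spinorRep hw
  rw [spinorRep_ι, map_mul, map_mul, spinorRep_ι] at this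
  rw [this, ← Matrix.conjTranspose_eq_transpose_of_trivial, ← Matrix.star_eq_conjTranspose,
    ← spinorRep_star]
  rfl

/-- An element of `Spin(7)` rotates the seven 2-forms `ωᵢ` among themselves by an orthogonal
matrix, so that it preserves `∑ᵢ ωᵢ ⊗ ωᵢ`. -/
theorem sum_spinorPairing_mul (s : spinGroup Q7) (a b c d : E8) :
    ∑ i, spinorPairing (unit7 i) (spinorOp (spinorRep (s : CliffordAlgebra Q7)) a)
          (spinorOp (spinorRep (s : CliffordAlgebra Q7)) b) *
        spinorPairing (unit7 i) (spinorOp (spinorRep (s : CliffordAlgebra Q7)) c)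
          (spinorOp (spinorRep (s : CliffordAlgebra Q7)) d) =
      ∑ i, spinorPairing (unit7 i) a b * spinorPairing (unit7 i) c d := by
  choose R hR using fun i => exists_conj_cliffordMul s (unit7 i)
  set S := spinorRep (s : CliffordAlgebra Q7) with hS
  have hSS : S.transpose * S = 1 := transpose_spinorRep_mul_self s
  have hSS' : S * S.transpose = 1 := mul_eq_one_comm.1 hSS
  have hmul : ∀ i j, cliffordMul (R i) * cliffordMul (R j) =
      S.transpose * (cliffordMul (unit7 i) * cliffordMul (unit7 j)) * S := by
    intro i j
    rw [← hR, ← hR]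
    calc _ = S.transpose * cliffordMul (unit7 i) * (S * S.transpose) *
          cliffordMul (unit7 j) * S := by simp only [Matrix.mul_assoc]
      _ = _ := by rw [hSS']; simp only [Matrix.mul_assoc, Matrix.one_mul]
  have hRR : Matrix.of R * (Matrix.of R).transpose = 1 := by
    ext i j
    have h1 := cliffordMul_mul_add (R i) (R j)
    rw [hmul, hmul, ← Matrix.add_mul, ← Matrix.mul_add, cliffordMul_mul_add, Matrix.mul_smul,
      Matrix.smul_mul, Matrix.mul_one, hSS] at h1
    have h2 := congrFun (congrFun h1 0) 0
    have h3 : ∑ k, unit7 i k * unit7 j k = if i = j then 1 else 0 := by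
      simp [Pi.single_apply, eq_comm]
    rw [h3] at h2
    simp only [Matrix.smul_apply, Matrix.one_apply_eq, smul_eq_mul, mul_one] at h2
    simp only [Matrix.mul_apply, Matrix.of_apply, Matrix.transpose_apply, Matrix.one_apply]
    linarith
  have hRR' : (Matrix.of R).transpose * Matrix.of R = 1 := mul_eq_one_comm.1 hRR
  have hP : ∀ i a b, spinorPairing (unit7 i) (spinorOp S a) (spinorOp S b) =
      ∑ k, R i k * spinorPairing (unit7 k) a b := by
    intro i a b
    have h1 : R i = ∑ k, R i k • unit7 k := by
      funext k; simp [Pi.single_apply]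
    rw [← spinorPairing_sum, ← h1, spinorPairing, inner_spinorOp, spinorPairing, ← hR]
    simp only [spinorOp, map_mul, mul_apply_eq_comp]
  have hk : ∀ k l, ∑ i, R i k * R i l = if k = l then 1 else 0 := by
    intro k l
    have := congrFun (congrFun hRR' k) l
    simpa only [Matrix.mul_apply, Matrix.of_apply, Matrix.transpose_apply,
      Matrix.one_apply] using this
  simp only [hP]
  calc _ = ∑ k, ∑ l, (∑ i, R i k * R i l) *
        (spinorPairing (unit7 k) a b * spinorPairing (unit7 l) c d) := by
        simp_rw [Finset.sum_mul_sum, Finset.sum_mul]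
        rw [Finset.sum_comm]
        refine Finset.sum_congr rfl fun k _ => ?_
        rw [Finset.sum_comm]
        exact Finset.sum_congr rfl fun l _ => Finset.sum_congr rfl fun i _ => by ring
    _ = _ := by simp [hk]

/-- The Cayley form is `Spin(7)`-invariant. -/
theorem cayleyForm_spinorOp (s : spinGroup Q7) (x : Fin 4 → E8) :
    cayleyForm (fun l => spinorOp (spinorRep (s : CliffordAlgebra Q7)) (x l)) = cayleyForm x := by
  rw [cayleyForm_apply, cayleyForm_apply]
  simp only [Finset.sum_add_distrib, Finset.sum_sub_distrib, sum_spinorPairing_mul]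

/-! ### Elements of `Spin(7)` -/

theorem star_ι_mul_self {u : Fin 7 → ℝ} (hu : Q7 u = -1) :
    star (CliffordAlgebra.ι Q7 u) * CliffordAlgebra.ι Q7 u = 1 := by
  rw [CliffordAlgebra.star_ι, neg_mul, CliffordAlgebra.ι_sq_scalar, hu, map_neg, map_one, neg_neg]

theorem ι_mul_star_self {u : Fin 7 → ℝ} (hu : Q7 u = -1) :
    CliffordAlgebra.ι Q7 u * star (CliffordAlgebra.ι Q7 u) = 1 := by
  rw [CliffordAlgebra.star_ι, mul_neg, CliffordAlgebra.ι_sq_scalar, hu, map_neg, map_one, neg_neg]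

theorem ι_mem_pinGroup {u : Fin 7 → ℝ} (hu : Q7 u = -1) :
    CliffordAlgebra.ι Q7 u ∈ pinGroup Q7 := by
  refine pinGroup.mem_iff.2 ⟨?_, star_ι_mul_self hu, ι_mul_star_self hu⟩
  let x : (CliffordAlgebra Q7)ˣ :=
    ⟨CliffordAlgebra.ι Q7 u, star (CliffordAlgebra.ι Q7 u), ι_mul_star_self hu,
      star_ι_mul_self hu⟩
  exact ⟨x, Subgroup.subset_closure ⟨u, rfl⟩, rfl⟩

/-- The product of two unit vectors of `ℝ⁷`, as an element of `Spin(7)`. -/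
def spinPair (u v : Fin 7 → ℝ) (hu : Q7 u = -1) (hv : Q7 v = -1) : spinGroup Q7 :=
  ⟨CliffordAlgebra.ι Q7 u * CliffordAlgebra.ι Q7 v,
    spinGroup.mem_iff.2 ⟨mul_mem (ι_mem_pinGroup hu) (ι_mem_pinGroup hv),
      CliffordAlgebra.ι_mul_ι_mem_evenOdd_zero Q7 u v⟩⟩

theorem spinorRep_spinPair {u v : Fin 7 → ℝ} (hu : Q7 u = -1) (hv : Q7 v = -1) :
    spinorRep (spinPair u v hu hv : CliffordAlgebra Q7) = cliffordMul u * cliffordMul v := by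
  rw [spinPair, map_mul, spinorRep_ι, spinorRep_ι]

/-- Four permutations of the seven imaginary units. -/
def twist : Fin 4 → Fin 7 → Fin 7 :=
  ![![0, 2, 1, 4, 3, 5, 6], ![0, 2, 1, 3, 4, 6, 5], ![2, 1, 0, 5, 4, 3, 6], ![4, 5, 2, 3, 0, 1, 6]]

/-- Signs which turn the permutations `twist t` into automorphisms `eᵢ ↦ ± e_{twist t i}` of the
octonions. -/
def twistSign : Fin 4 → Fin 7 → ℤ :=
  ![![1, 1, -1, -1, 1, 1, 1], ![1, 1, -1, 1, 1, -1, 1], ![1, 1, -1, 1, 1, -1, 1],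
    ![1, -1, 1, 1, -1, 1, 1]]

/-- Twice the matrix by which `e_a (e_b - e_a) e_c (σ e_d - e_c) / 2`, an element of `Spin(7)`, acts
on spinors. -/
def twistMatrix (a b c d : Fin 7) (σ : ℤ) : Matrix (Fin 8) (Fin 8) ℤ :=
  (1 + Matrix.of (gammaInt a) * Matrix.of (gammaInt b)) *
    (1 + σ • (Matrix.of (gammaInt c) * Matrix.of (gammaInt d)))

theorem exists_twistMatrix (t : Fin 4) : ∃ a b c d σ, a ≠ b ∧ c ≠ d ∧ σ * σ = 1 ∧
    (∀ l, twistMatrix a b c d σ l 0 = if l = 0 then 2 else 0) ∧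
    ∀ l i, twistMatrix a b c d σ l i.succ =
      if l = (twist t i).succ then 2 * twistSign t i else 0 := by
  let q : Fin 4 → Fin 7 × Fin 7 × Fin 7 × Fin 7 × ℤ :=
    ![(1, 2, 3, 4, -1), (1, 2, 5, 6, -1), (0, 2, 3, 5, 1), (0, 4, 1, 5, -1)]
  refine ⟨(q t).1, (q t).2.1, (q t).2.2.1, (q t).2.2.2.1, (q t).2.2.2.2, ?_⟩
  revert t
  decide +kernel

theorem Q7_unit7 (a : Fin 7) : Q7 (unit7 a) = -1 := by
  simp [Q7_apply, Pi.single_apply]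

/-- The unit vector `(σ e_b - e_a) / √2`. -/
def diagVec (a b : Fin 7) (σ : ℤ) : Fin 7 → ℝ :=
  (√2)⁻¹ • ((σ : ℝ) • unit7 b - unit7 a)

theorem Q7_diagVec {a b : Fin 7} {σ : ℤ} (hab : a ≠ b) (hσ : σ * σ = 1) :
    Q7 (diagVec a b σ) = -1 := by
  have h1 : ∀ i, diagVec a b σ i * diagVec a b σ i =
      (1 / 2) * (((if i = b then (σ : ℝ) * σ else 0)) + if i = a then 1 else 0) := by
    intro i
    have h2 : (√2)⁻¹ * (√2)⁻¹ = (1 / 2 : ℝ) := by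
      rw [← mul_inv, Real.mul_self_sqrt (by norm_num)]; norm_num
    simp only [diagVec, Pi.smul_apply, Pi.sub_apply, Pi.single_apply, smul_eq_mul]
    rw [mul_mul_mul_comm, h2]
    by_cases hb : i = b
    · have ha : i ≠ a := fun h => hab (h.symm.trans hb)
      simp [hb, hab.symm]
    · by_cases ha : i = a <;> simp [ha, hb, hab]
  have h3 : (σ : ℝ) * σ = 1 := by exact_mod_cast hσ
  simp only [Q7_apply, h1, h3, ← Finset.mul_sum, Finset.sum_add_distrib]
  norm_num

theorem cliffordMul_unit7_mul_diagVec (a b : Fin 7) (σ : ℤ) :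
    cliffordMul (unit7 a) * cliffordMul (diagVec a b σ) =
      (√2)⁻¹ • (1 + (σ : ℝ) • (cliffordMul (unit7 a) * cliffordMul (unit7 b))) := by
  have h := cliffordMul_mul_self (unit7 a)
  rw [Q7_unit7, map_neg, map_one] at h
  rw [diagVec, map_smul, map_sub, map_smul, mul_smul_comm, mul_sub, h, mul_smul_comm,
    sub_neg_eq_add, add_comm]

theorem spinorOp_unit8 (M : Matrix (Fin 8) (Fin 8) ℝ) (l m : Fin 8) :
    spinorOp M (unit8 m) l = M l m := by
  simp [spinorOp]

/-- The automorphisms `eᵢ ↦ ± e_{twist t i}` of the octonions come from elements of `Spin(7)`. -/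
theorem exists_spinorOp_twist (t : Fin 4) : ∃ s : spinGroup Q7,
    spinorOp (spinorRep (s : CliffordAlgebra Q7)) (unit8 0) = unit8 0 ∧
    ∀ i, spinorOp (spinorRep (s : CliffordAlgebra Q7)) (unit8 i.succ) =
      (twistSign t i : ℝ) • unit8 (twist t i).succ := by
  obtain ⟨a, b, c, d, σ, hab, hcd, hσ, h0, h1⟩ := exists_twistMatrix t
  let s : spinGroup Q7 := spinPair (unit7 a) (diagVec a b 1) (Q7_unit7 a)
      (Q7_diagVec hab (one_mul 1)) *
    spinPair (unit7 c) (diagVec c d σ) (Q7_unit7 c) (Q7_diagVec hcd hσ)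
  have h2 : spinorRep (s : CliffordAlgebra Q7) =
      (1 / 2 : ℝ) • (twistMatrix a b c d σ).map (Int.cast : ℤ → ℝ) := by
    have h3 : (√2)⁻¹ * (√2)⁻¹ = (1 / 2 : ℝ) := by
      rw [← mul_inv, Real.mul_self_sqrt (by norm_num)]; norm_num
    have h4 : (twistMatrix a b c d σ).map (Int.cast : ℤ → ℝ) =
        (1 + (cliffordMul (unit7 a) * cliffordMul (unit7 b))) *
          (1 + (σ : ℝ) • (cliffordMul (unit7 c) * cliffordMul (unit7 d))) := by
      simp only [cliffordMul_unit7]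
      change (Int.castRingHom ℝ).mapMatrix (twistMatrix a b c d σ) = _
      rw [twistMatrix, map_mul, map_add, map_add, map_one, map_mul, map_zsmul, map_mul,
        ← Int.cast_smul_eq_zsmul ℝ]
      rfl
    have h5 : (s : CliffordAlgebra Q7) =
        (spinPair (unit7 a) (diagVec a b 1) _ _ : CliffordAlgebra Q7) *
          (spinPair (unit7 c) (diagVec c d σ) _ _ : CliffordAlgebra Q7) := rfl
    rw [h4, h5, map_mul, spinorRep_spinPair, spinorRep_spinPair, cliffordMul_unit7_mul_diagVec,
      cliffordMul_unit7_mul_diagVec, smul_mul_smul_comm, h3, Int.cast_one, one_smul]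
  refine ⟨s, ?_, fun i => ?_⟩
  · ext l
    rw [spinorOp_unit8, h2, Matrix.smul_apply, Matrix.map_apply, h0]
    by_cases hl : l = 0 <;> simp [hl]
  · ext l
    rw [spinorOp_unit8, h2, Matrix.smul_apply, Matrix.map_apply, h1]
    by_cases hl : l = (twist t i).succ <;> simp [hl]

/-- Whether the coefficient `f i j k` of an alternating 3-form which is invariant under the four
signed permutations vanishes because of `f 0 1 2 = 0` or because a signed permutation acts on it
by `-1`, as far as words of length `n` in the signed permutations can tell. -/
def vanishes : ℕ → Fin 7 → Fin 7 → Fin 7 → Bool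
  | 0, i, j, k => i < 3 && j < 3 && k < 3 && i ≠ j && j ≠ k && i ≠ k
  | n + 1, i, j, k => vanishes n i j k || decide (∃ t,
      vanishes n (twist t i) (twist t j) (twist t k) = true ∨
      (twist t (twist t i) = i ∧ twist t (twist t j) = j ∧ twist t (twist t k) = k ∧
        (twistSign t i * twistSign t j * twistSign t k) * (twistSign t (twist t i) *
          twistSign t (twist t j) * twistSign t (twist t k)) = -1))

theorem vanishes_of_lt : ∀ i j k, i < j → j < k → vanishes 4 i j k = true := by
  decide +kernel

theorem eq_zero_of_vanishes {f : Fin 7 → Fin 7 → Fin 7 → ℝ}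
    (h12 : ∀ i j k, f j i k = -f i j k) (h23 : ∀ i j k, f i k j = -f i j k)
    (h0 : f 0 1 2 = 0)
    (ht : ∀ t i j k, f i j k = (twistSign t i * twistSign t j * twistSign t k : ℤ) *
      f (twist t i) (twist t j) (twist t k)) (n : ℕ) :
    ∀ i j k, vanishes n i j k = true → f i j k = 0 := by
  induction n with
  | zero =>
    have h1 : f 1 0 2 = 0 := by rw [h12, h0, neg_zero]
    have h2 : f 0 2 1 = 0 := by rw [h23, h0, neg_zero]
    have h3 : f 2 0 1 = 0 := by rw [h12, h2, neg_zero]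
    have h4 : f 1 2 0 = 0 := by rw [h23, h1, neg_zero]
    have h5 : f 2 1 0 = 0 := by rw [h12, h4, neg_zero]
    have h6 : ∀ i j k : Fin 7, vanishes 0 i j k = true →
        (i = 0 ∧ j = 1 ∧ k = 2) ∨ (i = 1 ∧ j = 0 ∧ k = 2) ∨ (i = 0 ∧ j = 2 ∧ k = 1) ∨
        (i = 2 ∧ j = 0 ∧ k = 1) ∨ (i = 1 ∧ j = 2 ∧ k = 0) ∨ (i = 2 ∧ j = 1 ∧ k = 0) := by
      decide +kernel
    intro i j k h
    rcases h6 i j k h with ⟨rfl, rfl, rfl⟩ | ⟨rfl, rfl, rfl⟩ | ⟨rfl, rfl, rfl⟩ | ⟨rfl, rfl, rfl⟩ |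
      ⟨rfl, rfl, rfl⟩ | ⟨rfl, rfl, rfl⟩ <;> assumption
  | succ n ih =>
    intro i j k h
    rw [vanishes, Bool.or_eq_true, decide_eq_true_eq] at h
    rcases h with h | ⟨t, h | ⟨hi, hj, hk, hs⟩⟩
    · exact ih i j k h
    · rw [ht t, ih _ _ _ h, mul_zero]
    · have h1 := ht t (twist t i) (twist t j) (twist t k)
      rw [hi, hj, hk] at h1
      have h2 := ht t i j k
      rw [h1, ← mul_assoc, ← Int.cast_mul, hs] at h2
      push_cast at h2
      linarith

/-! ### The sphere as a homogeneous space -/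

/-- The unit `1` of the octonions, as a point of the sphere. -/
def pole : S7 := ⟨unit8 0, by simp⟩

theorem spinorOp_cliffordMul_unit8_zero_succ (v : Fin 7 → ℝ) (i : Fin 7) :
    spinorOp (cliffordMul v) (unit8 0) i.succ = v i := by
  rw [spinorOp_unit8]
  fin_cases i <;> simp [cliffordMul]

theorem spinorOp_cliffordMul_unit8_zero_zero (v : Fin 7 → ℝ) :
    spinorOp (cliffordMul v) (unit8 0) 0 = 0 := by
  rw [spinorOp_unit8]
  simp [cliffordMul]

theorem exists_unit_orthogonal (w : Fin 7 → ℝ) : ∃ u, Q7 u = -1 ∧ ∑ i, u i * w i = 0 := by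
  by_cases hw : w 0 = 0 ∧ w 1 = 0
  · exact ⟨unit7 0, Q7_unit7 0, by simp [Pi.single_apply, hw.1]⟩
  · have hpos : 0 < w 0 ^ 2 + w 1 ^ 2 := by
      rcases not_and_or.1 hw with h | h
      · have := sq_pos_of_ne_zero h; positivity
      · have := sq_pos_of_ne_zero h; positivity
    refine ⟨(√(w 0 ^ 2 + w 1 ^ 2))⁻¹ • ![-w 1, w 0, 0, 0, 0, 0, 0], ?_, ?_⟩
    · rw [QuadraticMap.map_smul, ← mul_inv, Real.mul_self_sqrt hpos.le, Q7_apply]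
      simp only [Fin.sum_univ_seven]
      simp
      field_simp
      ring
    · simp only [Fin.sum_univ_seven]
      simp
      ring

/-- `Spin(7)` acts transitively on the sphere: if the imaginary unit `u` is orthogonal to the
imaginary part of `x`, then `v = -u x` is an imaginary unit and `u (v 1) = x`. -/
theorem exists_spinAct_pole (x : S7) : ∃ s, spinAct s pole = x := by
  obtain ⟨u, hu, hux⟩ := exists_unit_orthogonal fun i => (x : E8) i.succ
  have huu : cliffordMul u * cliffordMul u = -1 := by
    rw [cliffordMul_mul_self, hu, map_neg, map_one]
  let v : Fin 7 → ℝ := fun i => -spinorOp (cliffordMul u) (x : E8) i.succ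
  have h0 : spinorOp (cliffordMul u) (x : E8) 0 = 0 := by
    have : spinorOp (cliffordMul u) (x : E8) 0 = -∑ i, u i * (x : E8) i.succ := by
      simp [spinorOp, Matrix.mulVec, dotProduct, cliffordMul, Fin.sum_univ_succ]
      ring
    rw [this, hux, neg_zero]
  have hv1 : spinorOp (cliffordMul v) (unit8 0) = -spinorOp (cliffordMul u) (x : E8) := by
    ext l
    refine Fin.cases ?_ (fun i => ?_) l
    · rw [spinorOp_cliffordMul_unit8_zero_zero, PiLp.neg_apply, h0, neg_zero]
    · rw [spinorOp_cliffordMul_unit8_zero_succ]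
      rfl
  have hu2 : spinorOp (cliffordMul u) (spinorOp (cliffordMul u) (x : E8)) = -x := by
    have : spinorOp (cliffordMul u * cliffordMul u) (x : E8) = -x := by
      rw [huu]; simp [spinorOp]
    rw [← this, spinorOp, spinorOp, map_mul]
    rfl
  have hv : Q7 v = -1 := by
    have h1 : inner ℝ (spinorOp (cliffordMul u) (x : E8)) (spinorOp (cliffordMul u) (x : E8)) =
        (1 : ℝ) := by
      have hx : ‖(x : E8)‖ = 1 := mem_sphere_zero_iff_norm.1 x.2
      rw [inner_spinorOp, cliffordMul_transpose, spinorOp, map_neg, neg_apply, hu2, neg_neg,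
        real_inner_self_eq_norm_sq, hx, one_pow]
    rw [PiLp.inner_apply, Fin.sum_univ_succ, h0] at h1
    rw [Q7_apply, neg_inj, ← h1]
    simp [v, sq]
  refine ⟨spinPair u v hu hv, Subtype.ext ?_⟩
  change spinorOp (spinorRep (spinPair u v hu hv : CliffordAlgebra Q7)) (unit8 0) = x
  rw [spinorRep_spinPair, spinorOp, map_mul]
  change spinorOp (cliffordMul u) (spinorOp (cliffordMul v) (unit8 0)) = x
  rw [hv1, map_neg, hu2, neg_neg]

section

attribute [local instance] finrank_E8

theorem mdifferentiable_spinAct (s : spinGroup Q7) :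
    MDifferentiable (𝓡 7) (𝓡 7) (spinAct s) := by
  have h1 : ContMDiff (𝓡 7) 𝓘(ℝ, E8) 1 fun x : S7 =>
      spinorOp (spinorRep (s : CliffordAlgebra Q7)) (x : E8) :=
    (spinorOp _).contMDiff.comp (contMDiff_val.of_le le_top)
  exact (h1.codRestrict_sphere fun x => (spinAct s x).2).mdifferentiable one_ne_zero

theorem inclDeriv_mfderiv_spinAct (s : spinGroup Q7) (x : S7) (v : TangentSpace (𝓡 7) x) :
    inclDeriv (spinAct s x) (mfderiv (𝓡 7) (𝓡 7) (spinAct s) x v) =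
      spinorOp (spinorRep (s : CliffordAlgebra Q7)) (inclDeriv x v) := by
  have h1 := mfderiv_comp x (mdifferentiable_val (spinAct s x)) (mdifferentiable_spinAct s x)
  have h2 := mfderiv_comp x (I' := 𝓘(ℝ, E8))
    ((spinorOp (spinorRep (s : CliffordAlgebra Q7))).contMDiff.mdifferentiable one_ne_zero
      (x : E8) : MDifferentiableAt 𝓘(ℝ, E8) 𝓘(ℝ, E8) _ _) (mdifferentiable_val x)
  have h3 : (Subtype.val : S7 → E8) ∘ spinAct s =
    spinorOp (spinorRep (s : CliffordAlgebra Q7)) ∘ (Subtype.val : S7 → E8) := rfl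
  rw [h3] at h1
  have h4 := DFunLike.congr_fun (h1.symm.trans h2) v
  rw [ContinuousLinearMap.mfderiv_eq] at h4
  exact h4

end

/-! ### The standard `G₂`-structure of the sphere -/

/-- The restriction to `S⁷` of the 3-form `ι_x Φ` on `ℝ⁸`, where `Φ` is the Cayley form. -/
def stdForm : DiffForm S7 3 := restrict fun x => cayleyForm.curryLeft x

/-- The restriction of the Cayley form to `S⁷`. -/
def stdFourForm : DiffForm S7 4 := restrict fun _ => cayleyForm

theorem extd_smul_stdForm (c : ℝ) : extd (c • stdForm) = (c * 4) • stdFourForm := by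
  have h1 : Differentiable ℝ fun x : E8 => cayleyForm.curryLeft x :=
    cayleyForm.curryLeft.differentiable
  rw [stdForm, stdFourForm, ← restrict_smul, extd_restrict (h1.const_smul c), ← restrict_smul]
  congr 1
  funext x
  rw [extDeriv_smul, Pi.smul_apply, extDeriv]
  have h2 : fderiv ℝ (fun x : E8 => cayleyForm.curryLeft x) x = cayleyForm.curryLeft :=
    cayleyForm.curryLeft.fderiv
  rw [h2, ContinuousAlternatingMap.alternatizeUncurryFin_curryLeft, mul_smul]
  congr 1
  rw [← Nat.cast_smul_eq_nsmul ℝ]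
  norm_num

theorem extd_smul_stdFourForm (c : ℝ) : extd (c • stdFourForm) = 0 := by
  rw [stdFourForm, ← restrict_smul, extd_restrict (by fun_prop)]
  have : extDeriv (c • fun _ : E8 => cayleyForm) = 0 := by
    funext x
    have : (c • fun _ : E8 => cayleyForm) = fun _ => c • cayleyForm := rfl
    rw [this, extDeriv, fderiv_fun_const]
    exact map_zero (ContinuousAlternatingMap.alternatizeUncurryFinCLM ℝ E8 ℝ)
  rw [this, restrict_zero]

theorem extd_zero {k : ℕ} : extd (0 : DiffForm S7 k) = 0 := by
  rw [← restrict_zero, extd_restrict (β := 0) (differentiable_const 0)]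
  have : extDeriv (0 : E8 → E8 [⋀^Fin k]→L[ℝ] ℝ) = 0 := by
    funext x
    have h0 : (0 : E8 → E8 [⋀^Fin k]→L[ℝ] ℝ) = fun _ => 0 := rfl
    rw [h0, extDeriv, fderiv_fun_const]
    exact map_zero (ContinuousAlternatingMap.alternatizeUncurryFinCLM ℝ E8 ℝ)
  rw [this, restrict_zero]

theorem isSmooth_smul_stdForm (c : ℝ) : IsSmooth (c • stdForm) := by
  rw [stdForm, ← restrict_smul]
  exact isSmooth_restrict (contDiff_const.smul cayleyForm.curryLeft.contDiff)

theorem inner_spinorOp_spinorOp (s : spinGroup Q7) (a b : E8) :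
    inner ℝ (spinorOp (spinorRep (s : CliffordAlgebra Q7)) a)
      (spinorOp (spinorRep (s : CliffordAlgebra Q7)) b) = inner ℝ a b := by
  rw [inner_spinorOp]
  have : spinorOp ((spinorRep (s : CliffordAlgebra Q7)).transpose *
      spinorRep (s : CliffordAlgebra Q7)) b = b := by
    rw [transpose_spinorRep_mul_self]; simp [spinorOp]
  conv_rhs => rw [← this, spinorOp, map_mul]
  rfl

/-- If `s ∈ Spin(7)` maps the pole to `x`, it maps the imaginary units to a basis of the tangent
space at `x`. -/
theorem exists_frame {s : spinGroup Q7} {x : S7} (hs : spinAct s pole = x) :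
    ∃ b : Module.Basis (Fin 7) ℝ (TangentSpace (𝓡 7) x),
      ∀ i, inclDeriv x (b i) = spinorOp (spinorRep (s : CliffordAlgebra Q7)) (unit8 i.succ) := by
  have hx : (x : E8) = spinorOp (spinorRep (s : CliffordAlgebra Q7)) (unit8 0) := by
    rw [← hs]; rfl
  have h1 : ∀ i : Fin 7, ∃ w, inclDeriv x w =
      spinorOp (spinorRep (s : CliffordAlgebra Q7)) (unit8 i.succ) := by
    intro i
    have : spinorOp (spinorRep (s : CliffordAlgebra Q7)) (unit8 i.succ) ∈ (inclDeriv x).range := by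
      rw [range_inclDeriv, Submodule.mem_orthogonal_singleton_iff_inner_right, hx,
        inner_spinorOp_spinorOp]
      simp [EuclideanSpace.inner_single_left, Fin.succ_ne_zero]
    exact this
  choose w hw using h1
  have hli : LinearIndependent ℝ (inclDeriv x ∘ w) := by
    refine Orthonormal.linearIndependent (orthonormal_iff_ite.2 fun i j => ?_)
    rw [Function.comp_apply, Function.comp_apply, hw, hw, inner_spinorOp_spinorOp]
    simp [EuclideanSpace.inner_single_left]
  have hli' : LinearIndependent ℝ w :=
    LinearIndependent.of_comp (inclDeriv x : TangentSpace (𝓡 7) x →ₗ[ℝ] E8) hli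
  have hcard : Fintype.card (Fin 7) = Module.finrank ℝ (TangentSpace (𝓡 7) x) :=
    (finrank_euclideanSpace (𝕜 := ℝ) (ι := Fin 7)).symm
  refine ⟨basisOfLinearIndependentOfCardEqFinrank hli' hcard, fun i => ?_⟩
  rw [coe_basisOfLinearIndependentOfCardEqFinrank, hw]

theorem cayleyForm_spinorOp_unit8 (s : spinGroup Q7) (a b c d : Fin 8) :
    3 * cayleyForm ![spinorOp (spinorRep (s : CliffordAlgebra Q7)) (unit8 a),
      spinorOp (spinorRep (s : CliffordAlgebra Q7)) (unit8 b),
      spinorOp (spinorRep (s : CliffordAlgebra Q7)) (unit8 c),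
      spinorOp (spinorRep (s : CliffordAlgebra Q7)) (unit8 d)] = cayleyInt a b c d := by
  rw [← cayleyForm_unit8, ← cayleyForm_spinorOp s ![unit8 a, unit8 b, unit8 c, unit8 d]]
  congr 2
  funext l
  fin_cases l <;> rfl

theorem stdFourForm_apply {x : S7} (w : Fin 4 → TangentSpace (𝓡 7) x) :
    stdFourForm x w = cayleyForm ![inclDeriv x (w 0), inclDeriv x (w 1), inclDeriv x (w 2),
      inclDeriv x (w 3)] := by
  change cayleyForm (inclDeriv x ∘ w) = _
  congr 1
  funext l
  fin_cases l <;> rfl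

theorem stdForm_apply {x : S7} (w : Fin 3 → TangentSpace (𝓡 7) x) :
    stdForm x w = cayleyForm ![(x : E8), inclDeriv x (w 0), inclDeriv x (w 1),
      inclDeriv x (w 2)] := by
  change cayleyForm (Matrix.vecCons (x : E8) (inclDeriv x ∘ w)) = _
  congr 1
  funext l
  fin_cases l <;> rfl

theorem isG2Frame_stdForm {s : spinGroup Q7} {x : S7} (hs : spinAct s pole = x)
    {b : Module.Basis (Fin 7) ℝ (TangentSpace (𝓡 7) x)}
    (hb : ∀ i, inclDeriv x (b i) =
      spinorOp (spinorRep (s : CliffordAlgebra Q7)) (unit8 i.succ)) :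
    IsG2Frame b (stdForm x) (stdFourForm x) := by
  have hx : (x : E8) = spinorOp (spinorRep (s : CliffordAlgebra Q7)) (unit8 0) := by
    rw [← hs]; rfl
  refine ⟨fun i j k => ?_, fun i j k l => ?_⟩
  · have h1 := cayleyForm_spinorOp_unit8 s 0 i.succ j.succ k.succ
    rw [cayleyInt_zero] at h1
    push_cast at h1
    have h2 : stdForm x ![b i, b j, b k] = _ := stdForm_apply _
    rw [h2, hx]
    simp only [Matrix.cons_val_zero, Matrix.cons_val_one, Matrix.cons_val, hb]
    linarith
  · rw [← cayleyForm_spinorOp_unit8 s, stdFourForm_apply]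
    simp only [Matrix.cons_val_zero, Matrix.cons_val_one, Matrix.cons_val, hb]

/-- The inner product and the volume form for which a given basis is orthonormal and oriented. -/
theorem exists_metric_vol {V : Type*} [NormedAddCommGroup V] [NormedSpace ℝ V]
    (b : Module.Basis (Fin 7) ℝ V) :
    ∃ (g : LinearMap.BilinForm ℝ V) (vol : V [⋀^Fin 7]→L[ℝ] ℝ),
      (∀ i j, g (b i) (b j) = if i = j then 1 else 0) ∧ vol b = 1 := by
  have := b.finiteDimensional_of_finite
  refine ⟨∑ i, LinearMap.BilinForm.linMulLin (b.coord i) (b.coord i),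
    { b.det with cont := ?_ }, fun i j => ?_, b.det_self⟩
  · change Continuous fun v => b.det v
    simp only [Module.Basis.det_apply]
    refine Continuous.matrix_det (continuous_pi fun i => continuous_pi fun j => ?_)
    exact ((b.coord i).continuous_of_finiteDimensional).comp (continuous_apply j)
  · simp [LinearMap.sum_apply, Finsupp.single_apply]

/-- The inner product and the volume form induced by the standard `G₂`-structure at `x`, together
with an adapted orthonormal frame. -/
theorem exists_oriented_frame (x : S7) :
    ∃ (b : Module.Basis (Fin 7) ℝ (TangentSpace (𝓡 7) x))
      (g : LinearMap.BilinForm ℝ (TangentSpace (𝓡 7) x))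
      (vol : TangentSpace (𝓡 7) x [⋀^Fin 7]→L[ℝ] ℝ),
      (∀ i j, g (b i) (b j) = if i = j then 1 else 0) ∧ vol b = 1 ∧
      IsG2Frame b (stdForm x) (stdFourForm x) := by
  obtain ⟨s, hs⟩ := exists_spinAct_pole x
  obtain ⟨b, hb⟩ := exists_frame hs
  obtain ⟨g, vol, h⟩ := exists_metric_vol (V := E7) b
  exact ⟨b, g, vol, h.1, h.2, isG2Frame_stdForm hs hb⟩

variable {A : ℝ}

theorem isPositive_smul_stdForm (hA : A ≠ 0) (x : S7) : IsPositive ((A ^ 3 • stdForm) x) := by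
  obtain ⟨b, g, vol, hg, hvol, h⟩ := exists_oriented_frame x
  exact ⟨(A ^ 2 • g, A ^ 7 • vol), (h.induces hg hvol).smul hA⟩

theorem starOf_three (hA : A ≠ 0) (c : ℝ) :
    starOf (A ^ 3 • stdForm) 3 4 rfl (c • stdForm) = (c * A) • stdFourForm := by
  funext x
  obtain ⟨b, g, vol, hg, hvol, h⟩ := exists_oriented_frame x
  obtain ⟨h1, h2⟩ := ((h.induces hg hvol).smul hA).induced_eq b
  have h3 := hodgeStar_scale (k := 3) (m := 4) vol (c • stdForm x) hg hA (A ^ 7)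
  rw [hodgeStar_smul (g := g), h.hodgeStar_assoc hg hvol, smul_smul] at h3
  have h4 : A ^ 7 * (A⁻¹) ^ (2 * 3) * c = c * A := by rw [inv_pow]; norm_num; field_simp
  rw [h4] at h3
  rw [starOf, Pi.smul_apply, Pi.smul_apply, h1, h2]
  exact h3

theorem starOf_four (hA : A ≠ 0) (c : ℝ) :
    starOf (A ^ 3 • stdForm) 4 3 rfl (c • stdFourForm) = (c * A⁻¹) • stdForm := by
  funext x
  obtain ⟨b, g, vol, hg, hvol, h⟩ := exists_oriented_frame x
  obtain ⟨h1, h2⟩ := ((h.induces hg hvol).smul hA).induced_eq b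
  have h3 := hodgeStar_scale (k := 4) (m := 3) vol (c • stdFourForm x) hg hA (A ^ 7)
  rw [hodgeStar_smul (g := g), h.hodgeStar_coassoc hg hvol, smul_smul] at h3
  have h4 : A ^ 7 * (A⁻¹) ^ (2 * 4) * c = c * A⁻¹ := by rw [inv_pow]; norm_num; field_simp
  rw [h4] at h3
  rw [starOf, Pi.smul_apply, Pi.smul_apply, h1, h2]
  exact h3

theorem starOf_zero (φ : DiffForm S7 3) {k m : ℕ} (h : k + m = 7) : starOf φ k m h 0 = 0 := by
  funext x
  have h1 := hodgeStar_smul (g := inducedMetric (φ x)) (castDegree h.symm (inducedVol (φ x))) 0 0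
  rwa [zero_smul, zero_smul] at h1

/-- Of the two summands of the Laplacian, `d δ` vanishes because the 4-form is closed, and `δ d`
multiplies by `4` twice, once for each exterior derivative. -/
theorem g2Laplacian_smul_stdForm (hA : A ≠ 0) :
    g2Laplacian (A ^ 3 • stdForm) = (16 * A) • stdForm := by
  rw [g2Laplacian, hodgeLaplacian, codiff, codiff, extd_smul_stdForm]
  rw [starOf_four hA, extd_smul_stdForm, starOf_three hA, extd_smul_stdFourForm, starOf_zero,
    smul_zero, extd_zero, add_zero]
  have h1 : starOf (A ^ 3 • stdForm) (3 + 1) 3 (by omega) =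
      starOf (A ^ 3 • stdForm) 4 3 rfl := rfl
  have h2 := starOf_four hA (A ^ 3 * 4 * A⁻¹ * 4)
  rw [← h1] at h2
  rw [h2, smul_smul]
  congr 1
  field_simp
  norm_num

/-! ### Invariant 3-forms on the sphere -/

theorem IsSpin7Invariant.apply_eq {k : ℕ} {α : DiffForm S7 k} (hα : IsSpin7Invariant α)
    {s : spinGroup Q7} {x y : S7} (hs : spinAct s x = y) {w : Fin k → TangentSpace (𝓡 7) x}
    {w' : Fin k → TangentSpace (𝓡 7) y}
    (hw : ∀ l, inclDeriv y (w' l) =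
      spinorOp (spinorRep (s : CliffordAlgebra Q7)) (inclDeriv x (w l))) :
    α y w' = α x w := by
  subst hs
  have h1 : w' = fun l => mfderiv (𝓡 7) (𝓡 7) (spinAct s) x (w l) :=
    funext fun l => inclDeriv_injective _ ((hw l).trans (inclDeriv_mfderiv_spinAct s x (w l)).symm)
  rw [h1]
  exact congrArg (fun β : DiffForm S7 k => β x w) (hα s)

theorem isSpin7Invariant_smul_stdForm (c : ℝ) : IsSpin7Invariant (c • stdForm) := by
  intro s
  funext x
  ext w
  change c * stdForm (spinAct s x) (fun l => mfderiv (𝓡 7) (𝓡 7) (spinAct s) x (w l)) =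
    c * stdForm x w
  rw [stdForm_apply, stdForm_apply, ← cayleyForm_spinorOp s
    ![(x : E8), inclDeriv x (w 0), inclDeriv x (w 1), inclDeriv x (w 2)]]
  simp only [inclDeriv_mfderiv_spinAct]
  congr 2
  funext l
  fin_cases l <;> rfl

theorem spinAct_one (x : S7) : spinAct 1 x = x := by
  refine Subtype.ext ?_
  change spinorOp (spinorRep (1 : CliffordAlgebra Q7)) (x : E8) = x
  rw [map_one]
  simp [spinorOp]

/-- The imaginary units as a basis of the tangent space at the pole. -/
theorem exists_frame_pole : ∃ b : Module.Basis (Fin 7) ℝ (TangentSpace (𝓡 7) pole),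
    ∀ i, inclDeriv pole (b i) = unit8 i.succ := by
  obtain ⟨b, hb⟩ := exists_frame (spinAct_one pole)
  refine ⟨b, fun i => (hb i).trans ?_⟩
  change spinorOp (spinorRep (1 : CliffordAlgebra Q7)) (unit8 i.succ) = _
  rw [map_one]
  simp [spinorOp]

/-- An invariant form is determined by its value at the pole. -/
theorem IsSpin7Invariant.eq_zero {k : ℕ} {α : DiffForm S7 k} (hα : IsSpin7Invariant α)
    (h0 : α pole = 0) : α = 0 := by
  funext x
  obtain ⟨s, hs⟩ := exists_spinAct_pole x
  obtain ⟨b, hb⟩ := exists_frame hs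
  obtain ⟨b', hb'⟩ := exists_frame_pole
  refine continuousAlternating_ext_basis (E := E7) b _ _ fun J => ?_
  have h1 : α x (b ∘ J) = α pole (b' ∘ J) :=
    hα.apply_eq hs fun l => by rw [Function.comp_apply, Function.comp_apply, hb, hb']
  rw [h0] at h1
  exact h1

/-- An invariant 3-form vanishes if it vanishes on `e₁, e₂, e₃` at the pole: under the four signed
permutations, each coefficient equals the opposite of itself or `±` the coefficient at
`e₁, e₂, e₃`. -/
theorem IsSpin7Invariant.eq_zero_of_apply {α : DiffForm S7 3} (hα : IsSpin7Invariant α)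
    {b : Module.Basis (Fin 7) ℝ (TangentSpace (𝓡 7) pole)}
    (hb : ∀ i, inclDeriv pole (b i) = unit8 i.succ) (h0 : α pole ![b 0, b 1, b 2] = 0) :
    α = 0 := by
  refine hα.eq_zero (ContinuousAlternatingMap.toAlternatingMap_injective
    (alternating_ext_strictMono b fun J hJ => ?_))
  have h1 : ∀ i j k, α pole ![b j, b i, b k] = -α pole ![b i, b j, b k] := by
    intro i j k
    rw [← ContinuousAlternatingMap.coe_toAlternatingMap,
      ← (α pole).toAlternatingMap.map_swap _ (show (0 : Fin 3) ≠ 1 by decide)]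
    congr 1
    funext l
    fin_cases l <;> rfl
  have h2 : ∀ i j k, α pole ![b i, b k, b j] = -α pole ![b i, b j, b k] := by
    intro i j k
    rw [← ContinuousAlternatingMap.coe_toAlternatingMap,
      ← (α pole).toAlternatingMap.map_swap _ (show (1 : Fin 3) ≠ 2 by decide)]
    congr 1
    funext l
    fin_cases l <;> rfl
  have h3 : ∀ t i j k, α pole ![b i, b j, b k] =
      (twistSign t i * twistSign t j * twistSign t k : ℤ) *
        α pole ![b (twist t i), b (twist t j), b (twist t k)] := by
    intro t i j k
    obtain ⟨s, hs0, hs⟩ := exists_spinorOp_twist t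
    have hpole : spinAct s pole = pole := Subtype.ext hs0
    have h4 : α pole (fun l => (![(twistSign t i : ℝ), twistSign t j, twistSign t k] l) •
        (![b (twist t i), b (twist t j), b (twist t k)] l)) = α pole ![b i, b j, b k] := by
      refine hα.apply_eq hpole fun l => ?_
      fin_cases l <;> simp only [map_smul] <;>
        exact (congrArg _ (hb _)).trans ((hs _).symm.trans (congrArg _ (hb _).symm))
    rw [← h4, ContinuousAlternatingMap.map_smul_univ, Fin.prod_univ_three]
    push_cast
    rfl
  have h4 := eq_zero_of_vanishes h1 h2 h0 h3 4 _ _ _ (vanishes_of_lt (J 0) (J 1) (J 2)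
    (hJ (by decide)) (hJ (by decide)))
  rw [tuple_three J, comp_three]
  exact h4

theorem stdForm_pole {b : Module.Basis (Fin 7) ℝ (TangentSpace (𝓡 7) pole)}
    (hb : ∀ i, inclDeriv pole (b i) = unit8 i.succ) : stdForm pole ![b 0, b 1, b 2] = 1 := by
  have hb' : ∀ i, inclDeriv pole (b i) =
      spinorOp (spinorRep ((1 : spinGroup Q7) : CliffordAlgebra Q7)) (unit8 i.succ) := by
    intro i
    change _ = spinorOp (spinorRep (1 : CliffordAlgebra Q7)) (unit8 i.succ)
    rw [hb, map_one]
    simp [spinorOp]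
  rw [(isG2Frame_stdForm (spinAct_one pole) hb').assoc]
  have : assocInt 0 1 2 = 1 := by decide +kernel
  rw [this, Int.cast_one]

/-- The invariant 3-forms are the multiples of the standard one. -/
theorem IsSpin7Invariant.exists_eq_smul {α : DiffForm S7 3} (hα : IsSpin7Invariant α) :
    ∃ c : ℝ, α = c • stdForm := by
  obtain ⟨b, hb⟩ := exists_frame_pole
  have h1 := stdForm_pole hb
  set c := α pole ![b 0, b 1, b 2] with hc
  refine ⟨c, ?_⟩
  have h2 : IsSpin7Invariant (α - c • stdForm) := by
    intro s
    have h3 : pullback (spinAct s) (α - c • stdForm) =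
      pullback (spinAct s) α - pullback (spinAct s) (c • stdForm) := rfl
    rw [h3, hα s, isSpin7Invariant_smul_stdForm c s]
  refine sub_eq_zero.1 (h2.eq_zero_of_apply hb ?_)
  change α pole ![b 0, b 1, b 2] - c * stdForm pole ![b 0, b 1, b 2] = 0
  rw [h1, ← hc]
  ring

theorem not_isPositive_zero_sphere (x : S7) : ¬ IsPositive ((0 : DiffForm S7 3) x) := by
  obtain ⟨b, -⟩ := exists_oriented_frame x
  exact not_isPositive_zero b

theorem exists_pow_three_eq {c : ℝ} (hc : c ≠ 0) : ∃ A : ℝ, A ≠ 0 ∧ A ^ 3 = c := by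
  have hpos : ∀ d : ℝ, 0 < d → ∃ A : ℝ, A ^ 3 = d := fun d hd =>
    ⟨d ^ ((3 : ℕ) : ℝ)⁻¹, Real.rpow_inv_natCast_pow hd.le (by norm_num)⟩
  obtain ⟨A, hA⟩ : ∃ A : ℝ, A ^ 3 = c := by
    rcases lt_or_gt_of_ne hc with h | h
    · obtain ⟨A, hA⟩ := hpos (-c) (neg_pos.2 h)
      exact ⟨-A, by rw [Odd.neg_pow (by decide), hA, neg_neg]⟩
    · exact hpos c h
  exact ⟨A, fun h => hc (by rw [← hA, h]; norm_num), hA⟩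

theorem pow_three_injective : Function.Injective fun A : ℝ => A ^ 3 :=
  (Odd.strictMono_pow (by decide)).injective

theorem smul_stdForm_injective : Function.Injective fun c : ℝ => c • stdForm := by
  intro c c' h
  obtain ⟨b, hb⟩ := exists_frame_pole
  have h1 : c * stdForm pole ![b 0, b 1, b 2] = c' * stdForm pole ![b 0, b 1, b 2] :=
    congrArg (fun α : DiffForm S7 3 => α pole ![b 0, b 1, b 2]) h
  rwa [stdForm_pole hb, mul_one, mul_one] at h1

theorem neg_smul_stdForm (c : ℝ) : -(c • stdForm) = (-c) • stdForm := by
  funext x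
  ext w
  exact (neg_mul c _).symm

theorem mem_posSpin7Forms_iff {φ : DiffForm S7 3} :
    φ ∈ posSpin7Forms ↔ ∃ A : ℝ, A ≠ 0 ∧ φ = A ^ 3 • stdForm := by
  constructor
  · rintro ⟨⟨-, hpos⟩, hinv⟩
    obtain ⟨c, rfl⟩ := hinv.exists_eq_smul
    obtain ⟨A, hA, rfl⟩ := exists_pow_three_eq (c := c) (by
      rintro rfl
      rw [zero_smul] at hpos
      exact not_isPositive_zero_sphere pole (hpos pole))
    exact ⟨A, hA, rfl⟩
  · rintro ⟨A, hA, rfl⟩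
    exact ⟨⟨isSmooth_smul_stdForm _, isPositive_smul_stdForm hA⟩, isSpin7Invariant_smul_stdForm _⟩

/-! ### The `G₂`-Laplacian on invariant forms -/

theorem smul_stdForm_mem {c : ℝ} (hc : c ≠ 0) : c • stdForm ∈ posSpin7Forms := by
  obtain ⟨A, hA, rfl⟩ := exists_pow_three_eq hc
  exact mem_posSpin7Forms_iff.2 ⟨A, hA, rfl⟩

theorem bijOn_g2Laplacian : Set.BijOn g2Laplacian posSpin7Forms posSpin7Forms := by
  refine ⟨fun φ hφ => ?_, fun φ hφ φ' hφ' h => ?_, fun φ hφ => ?_⟩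
  · obtain ⟨A, hA, rfl⟩ := mem_posSpin7Forms_iff.1 hφ
    rw [g2Laplacian_smul_stdForm hA]
    exact smul_stdForm_mem (mul_ne_zero (by norm_num) hA)
  · obtain ⟨A, hA, rfl⟩ := mem_posSpin7Forms_iff.1 hφ
    obtain ⟨A', hA', rfl⟩ := mem_posSpin7Forms_iff.1 hφ'
    rw [g2Laplacian_smul_stdForm hA, g2Laplacian_smul_stdForm hA'] at h
    rw [mul_left_cancel₀ (by norm_num) (smul_stdForm_injective h)]
  · obtain ⟨A, hA, rfl⟩ := mem_posSpin7Forms_iff.1 hφ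
    have hB : A ^ 3 / 16 ≠ 0 := div_ne_zero (pow_ne_zero 3 hA) (by norm_num)
    refine ⟨(A ^ 3 / 16) ^ 3 • stdForm, mem_posSpin7Forms_iff.2 ⟨_, hB, rfl⟩, ?_⟩
    rw [g2Laplacian_smul_stdForm hB]
    congr 1
    ring

theorem sameOrientation_g2Laplacian {φ : DiffForm S7 3} (hφ : φ ∈ posSpin7Forms) :
    SameOrientation φ (g2Laplacian φ) := by
  obtain ⟨A, hA, rfl⟩ := mem_posSpin7Forms_iff.1 hφ
  rw [g2Laplacian_smul_stdForm hA]
  obtain ⟨B, hB, hBA⟩ := exists_pow_three_eq (mul_ne_zero (by norm_num : (16 : ℝ) ≠ 0) hA)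
  rw [← hBA]
  intro x
  obtain ⟨b, g, vol, hg, hvol, h⟩ := exists_oriented_frame x
  have h1 : inducedVol ((A ^ 3 • stdForm) x) = A ^ 7 • vol :=
    (((h.induces hg hvol).smul hA).induced_eq b).2
  have h2 : inducedVol ((B ^ 3 • stdForm) x) = B ^ 7 • vol :=
    (((h.induces hg hvol).smul hB).induced_eq b).2
  have h3 : 0 < B / A := by
    have h4 : (B / A) ^ 3 = 16 / A ^ 2 := by
      rw [div_pow, hBA]
      field_simp
    have h5 : 0 < (B / A) ^ 3 := by rw [h4]; positivity
    exact (Odd.pow_pos_iff (by decide)).1 h5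
  refine ⟨(B / A) ^ 7, pow_pos h3 7, ?_⟩
  rw [h1, h2, smul_smul, div_pow, div_mul_cancel₀ _ (pow_ne_zero 7 hA)]

theorem bijOn_pow_three_smul {φ : DiffForm S7 3} (hφ : φ ∈ posSpin7Forms) :
    Set.BijOn (fun A : ℝ => A ^ 3 • φ) {A : ℝ | A ≠ 0} posSpin7Forms := by
  obtain ⟨B, hB, rfl⟩ := mem_posSpin7Forms_iff.1 hφ
  refine ⟨fun A hA => ?_, fun A _ A' _ h => ?_, fun ψ hψ => ?_⟩
  · change A ^ 3 • B ^ 3 • stdForm ∈ _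
    rw [smul_smul]
    exact smul_stdForm_mem (mul_ne_zero (pow_ne_zero 3 hA) (pow_ne_zero 3 hB))
  · change A ^ 3 • B ^ 3 • stdForm = A' ^ 3 • B ^ 3 • stdForm at h
    rw [smul_smul, smul_smul] at h
    exact pow_three_injective
      (mul_right_cancel₀ (pow_ne_zero 3 hB) (smul_stdForm_injective h))
  · obtain ⟨A, hA, rfl⟩ := mem_posSpin7Forms_iff.1 hψ
    refine ⟨A / B, div_ne_zero hA hB, ?_⟩
    change (A / B) ^ 3 • B ^ 3 • stdForm = _
    rw [smul_smul, div_pow, div_mul_cancel₀ _ (pow_ne_zero 3 hB)]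

theorem fixedPoints_g2Laplacian :
    {φ ∈ posSpin7Forms | g2Laplacian φ = φ} =
      {(64 : ℝ) • stdForm, -((64 : ℝ) • stdForm)} := by
  ext φ
  simp only [Set.mem_ofPred_eq, Set.mem_insert_iff, Set.mem_singleton_iff]
  constructor
  · rintro ⟨hφ, h⟩
    obtain ⟨A, hA, rfl⟩ := mem_posSpin7Forms_iff.1 hφ
    rw [g2Laplacian_smul_stdForm hA] at h
    have h1 : 16 * A = A ^ 3 := smul_stdForm_injective h
    have h2 : (A - 4) * (A + 4) = 0 := mul_left_cancel₀ hA (by linear_combination -h1)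
    rcases mul_eq_zero.1 h2 with h3 | h3
    · left
      rw [sub_eq_zero.1 h3]
      norm_num
    · right
      rw [eq_neg_of_add_eq_zero_left h3, neg_smul_stdForm]
      norm_num
  · rintro (rfl | rfl)
    · have h1 : (64 : ℝ) = 4 ^ 3 := by norm_num
      refine ⟨smul_stdForm_mem (by norm_num), ?_⟩
      conv_lhs => rw [h1, g2Laplacian_smul_stdForm (by norm_num)]
      norm_num
    · have h1 : (-64 : ℝ) = (-4) ^ 3 := by norm_num
      rw [neg_smul_stdForm]
      refine ⟨smul_stdForm_mem (by norm_num), ?_⟩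
      conv_lhs => rw [h1, g2Laplacian_smul_stdForm (by norm_num)]
      norm_num

end G2Laplacian

end

theorem mainTheorem2 :
    -- there are positive `Spin(7)`-invariant 3-forms on the 7-sphere
    G2Laplacian.posSpin7Forms.Nonempty ∧
    -- the `G₂`-Laplacian is a bijection of the space of these forms, preserving orientations
    Set.BijOn G2Laplacian.g2Laplacian G2Laplacian.posSpin7Forms G2Laplacian.posSpin7Forms ∧
    (∀ φ ∈ G2Laplacian.posSpin7Forms,
      G2Laplacian.SameOrientation φ (G2Laplacian.g2Laplacian φ)) ∧
    ∀ φ₀ ∈ G2Laplacian.posSpin7Forms,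
      -- the forms are exactly the `A³ φ₀` with `A ≠ 0`
      Set.BijOn (fun A : ℝ => A ^ 3 • φ₀) {A : ℝ | A ≠ 0} G2Laplacian.posSpin7Forms ∧
      ∃ K : ℝ, K ≠ 0 ∧
        G2Laplacian.extd φ₀ = K • G2Laplacian.starOf φ₀ 3 4 rfl φ₀ ∧
        (∀ A : ℝ, A ≠ 0 → G2Laplacian.g2Laplacian (A ^ 3 • φ₀) = (A * K ^ 2) • φ₀) ∧
        -- there are exactly two fixed points, `± K³ φ₀`
        {φ ∈ G2Laplacian.posSpin7Forms | G2Laplacian.g2Laplacian φ = φ} =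
          {K ^ 3 • φ₀, -(K ^ 3 • φ₀)} ∧
        K ^ 3 • φ₀ ≠ -(K ^ 3 • φ₀) := by
  refine ⟨⟨_, G2Laplacian.smul_stdForm_mem one_ne_zero⟩, G2Laplacian.bijOn_g2Laplacian,
    fun φ hφ => G2Laplacian.sameOrientation_g2Laplacian hφ, fun φ₀ hφ₀ =>
    ⟨G2Laplacian.bijOn_pow_three_smul hφ₀, ?_⟩⟩
  obtain ⟨B, hB, rfl⟩ := G2Laplacian.mem_posSpin7Forms_iff.1 hφ₀
  have hK : (4 / B) ^ 3 • B ^ 3 • G2Laplacian.stdForm = (64 : ℝ) • G2Laplacian.stdForm := by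
    rw [smul_smul, div_pow, div_mul_cancel₀ _ (pow_ne_zero 3 hB)]
    norm_num
  refine ⟨4 / B, div_ne_zero (by norm_num) hB, ?_, fun A hA => ?_, ?_, ?_⟩
  · rw [G2Laplacian.extd_smul_stdForm, G2Laplacian.starOf_three hB, smul_smul]
    congr 1
    field_simp
  · rw [smul_smul, smul_smul, ← mul_pow, G2Laplacian.g2Laplacian_smul_stdForm (mul_ne_zero hA hB)]
    congr 1
    field_simp
    norm_num
  · rw [hK, G2Laplacian.fixedPoints_g2Laplacian]
  · rw [hK, G2Laplacian.neg_smul_stdForm]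
    intro h
    have := G2Laplacian.smul_stdForm_injective h
    norm_num at this
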